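/- **Setting.** Let $K\ge 1$, let $\mathcal X$ be a measurable space and $D$ a probability distribution on $\mathcal X\times\mathbb R^K$ under which the loss vector lies in $[0,1]^K$ almost surely. Let $\Pi$ be a finite set of measurable policies $\pi:\mathcal X\to\{1,\dots,K\}$, $L(\pi)=\mathbb E_{(x,\ell)\sim D}[\ell(\pi(x))]$, $\pi^*\in\arg\min_{\pi\in\Pi}L(\pi)$, $\rho(\pi,\pi')=P_x(\pi(x)\ne\pi'(x))$, and $$\theta=\sup_{r>0}\frac1r\,P_x\big(\exists \pi\in\Pi:\ \rho(\pi,\pi^*)\le r,\ \pi(x)\ne\pi^*(x)\big).$$ Let $(x_t,\ell_t)_{t\ge1}$ be drawn from $D$, each independently of the past. For $\delta\in(0,1)$ and $\epsilon\in(0,1]$ put $\delta_T=\delta/(T^2+T)$, $e_T=2\log(2|\Pi|/\delta_T)/T$ for $T\ge1$, $e_0=0$, and $$\Delta_t=\Big(\sqrt{2K/\epsilon}+1\Big)\sqrt{e_{t-1}}+\Big(\frac K\epsilon+3\Big)e_{t-1}.$$ For a finite sample $Z$ of pairs (context, cost vector) let $L(\pi,Z)$ be the average of $c(\pi(x))$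 over $(x,c)\in Z$ (and $0$ if $Z$ is empty). **Algorithm (active $\epsilon$-greedy).** Start with the empty sample $\hat Z_0$. In round $t=1,2,\dots$ observe $x_t$; let $\pi_t$ minimize $L(\cdot,\hat Z_{t-1})$ over $\Pi$ (ties broken using only the past) and, for each action $a$ selected at $x_t$ by some policy of $\Pi$, let $\pi_{t,a}$ minimize $L(\cdot,\hat Z_{t-1})$ over $\{\pi\in\Pi:\pi(x_t)=a\}$; let $A_t$ be the set of those $a$ with $L(\pi_{t,a},\hat Z_{t-1})-L(\pi_t,\hat Z_{t-1})\le\Delta_t$. Given the past, $x_t$ and $\ell_t$, play $a_t$ with distribution $p_t$, where $p_t(\pi_t(x_t))=1-(|A_t|-1)\epsilon/K$, $p_t(a)=\epsilon/K$ for $a\in A_t\setminus\{\pi_t(x_t)\}$, and $p_t(a)=0$ otherwise. Observe $\ell_t(a_t)$ and let $\hat Z_t$ be $\hat Z_{t-1}$ with $(x_t,\hat\ell_t)$ added, where $\hat\ell_t(a)=\mathbf 1\{a=a_t\}\,\ell_t(a_t)/p_t(a_t)$ if $a\in A_t$ and $\hat\ell_t(a)=1$ otherwise. Let $\tilde\ell_t(a)=\ell_t(a)$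 if $a\in A_t$ and $\tilde\ell_t(a)=1$ otherwise, and let $L_T,\tilde L_T,\hat L_T$ be the averages of $\ell_t(\pi(x_t))$, $\tilde\ell_t(\pi(x_t))$, $\hat\ell_t(\pi(x_t))$ over $t\le T$. The regret is $R_T=\sum_{t=1}^T\big(\ell_t(a_t)-\ell_t(\pi^*(x_t))\big)$. Let $\mathcal E$ be the event that for all $\pi\in\Pi$ and all $T\ge1$ $$\big|(\hat L_T(\pi)-\hat L_T(\pi^*))-(\tilde L_T(\pi)-\tilde L_T(\pi^*))\big|\le\sqrt{2K\rho(\pi,\pi^*)e_T/\epsilon}+\Big(\frac K\epsilon+1\Big)e_T,$$ $$\big|(L_T(\pi)-L_T(\pi^*))-(L(\pi)-L(\pi^*))\big|\le\sqrt{\rho(\pi,\pi^*)e_T}+2e_T.$$ **Theorem.** There is a universal constant $C>0$ such that the following holds for all $T\ge2$ and $\delta\in(0,1)$, whenever the Massart condition $\rho(\pi,\pi^*)\le\frac1\tau(L(\pi)-L(\pi^*))$ for all $\pi\in\Pi$ holds with parameter $\tau>0$. 1. For every $\epsilon\in(0,1]$, $P(\mathcal E)\ge1-\delta$ and $$\mathbb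 E[R_T\mid\mathcal E]\le C\left(\frac{K\log(T|\Pi|/\delta)}{\tau\epsilon}\log T+\frac\theta\tau\sqrt{\epsilon KT\log(T|\Pi|/\delta)}\right).$$ 2. There is a choice of $\epsilon\in(0,1]$, depending only on $K,|\Pi|,T,\delta,\theta$, for which $$\mathbb E[R_T\mid\mathcal E]\le\frac C\tau\,\big(\theta K\log(T|\Pi|/\delta)\big)^{2/3}(T\log T)^{1/3}.$$ -/

import Mathlib

open MeasureTheory ProbabilityTheory

noncomputable section

namespace ActiveGreedy

/-- A stochastic contextual bandit problem with context space `X` and `K` actions: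
data distribution `D` on pairs (context, loss vector) with losses in `[0, 1]`, a finite class
`Pol` of measurable policies, and an optimal policy `opt` in the class. -/
structure Problem (X : Type*) [MeasurableSpace X] (K : ℕ) where
  D : Measure (X × (Fin K → ℝ))
  isProb : IsProbabilityMeasure D
  loss_mem : ∀ᵐ z ∂D, ∀ a, z.2 a ∈ Set.Icc (0 : ℝ) 1
  Pol : Finset (X → Fin K)
  measurable_pol : ∀ π ∈ Pol, Measurable π
  opt : X → Fin K
  opt_mem : opt ∈ Pol
  opt_min : ∀ π ∈ Pol, ∫ z, z.2 (opt z.1) ∂D ≤ ∫ z, z.2 (π z.1) ∂D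

namespace Problem

variable {X : Type*} [MeasurableSpace X] {K : ℕ} (B : Problem X K)

/-- Expected loss `L(π)`. -/
def risk (π : X → Fin K) : ℝ := ∫ z, z.2 (π z.1) ∂B.D

/-- Marginal distribution of the contexts. -/
def ctxLaw : Measure X := B.D.map Prod.fst

/-- Expected disagreement `ρ(π, π')`. -/
def rho (π π' : X → Fin K) : ℝ := B.ctxLaw.real {x | π x ≠ π' x}

/-- The Massart noise condition with parameter `τ`. -/
def Massart (τ : ℝ) : Prop :=
  0 < τ ∧ ∀ π ∈ B.Pol, B.rho π B.opt ≤ 1 / τ * (B.risk π - B.risk B.opt)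

/-- The disagreement region of radius `r` around the optimal policy. -/
def disRegion (r : ℝ) : Set X := {x | ∃ π ∈ B.Pol, B.rho π B.opt ≤ r ∧ π x ≠ B.opt x}

/-- The disagreement coefficient `θ = sup_{r > 0} P(x ∈ DIS(r)) / r`. For a finite class the
supremum is over a set bounded by the number of policies, so the real supremum is the true one. -/
def disCoeff : ℝ := ⨆ r : Set.Ioi (0 : ℝ), B.ctxLaw.real (B.disRegion r) / (r : ℝ)

end Problem

/-- `δ_T = δ / (T² + T)`. -/
def deltaT (δ : ℝ) (T : ℕ) : ℝ := δ / ((T : ℝ) ^ 2 + T)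

/-- `e_T = 2 log (2 N / δ_T) / T`, with `N` the number of policies (and `e_0 = 0`). -/
def eT (N : ℕ) (δ : ℝ) (T : ℕ) : ℝ := 2 * Real.log (2 * N / deltaT δ T) / T

/-- The threshold `Δ_t` of the algorithm, for rounds `t ≥ 1`. At `t = 1` there are no data, all
empirical losses vanish, and the value `Δ_1 = 0` keeps every action that some policy selects. -/
def threshold (K N : ℕ) (ε δ : ℝ) (t : ℕ) : ℝ :=
  (Real.sqrt (2 * K / ε) + 1) * Real.sqrt (eT N δ (t - 1)) + (K / ε + 3) * eT N δ (t - 1)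

section Algorithm

variable {X : Type*} {K : ℕ}

/-- Empirical loss `L(π, Z)` of a policy on a sample of (context, cost vector) pairs;
it is `0` on the empty sample. -/
def empLoss (Z : List (X × (Fin K → ℝ))) (π : X → Fin K) : ℝ :=
  (Z.map fun z => z.2 (π z.1)).sum / Z.length

/-- `π` is an output of the exact cost-sensitive oracle on the sample `Z`, with the search
restricted to the policies of `Pol` that satisfy `p`. -/
def IsOracle (Pol : Finset (X → Fin K)) (p : (X → Fin K) → Prop)
    (Z : List (X × (Fin K → ℝ))) (π : X → Fin K) : Prop :=
  π ∈ Pol ∧ p π ∧ ∀ π' ∈ Pol, p π' → empLoss Z π ≤ empLoss Z π'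

open Classical in
/-- The set `A_t` of explored actions, for the current sample `Z`, current policy `πt`, current
context `x` and threshold `Δ`. An action that no policy selects at `x` is not explored. -/
def exploreSet (Pol : Finset (X → Fin K)) (Δ : ℝ) (Z : List (X × (Fin K → ℝ)))
    (πt : X → Fin K) (x : X) : Finset (Fin K) :=
  {a | ∃ π, IsOracle Pol (fun π' => π' x = a) Z π ∧ empLoss Z π - empLoss Z πt ≤ Δ}

/-- The probabilities `p_t`, where `b` is the action of the current policy. -/
def playProb (ε : ℝ) (A : Finset (Fin K)) (b a : Fin K) : ℝ :=
  if a = b then 1 - ((A.card : ℝ) - 1) * ε / K else if a ∈ A then ε / K else 0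

/-- A deterministic record of an interaction: contexts, (full) loss vectors, played actions and
the policies `π_t` of the algorithm, at rounds `t = 1, 2, …` (the entries at `0` are unused). -/
structure Transcript (X : Type*) (K : ℕ) where
  ctx : ℕ → X
  loss : ℕ → Fin K → ℝ
  act : ℕ → Fin K
  pol : ℕ → X → Fin K

namespace Transcript

variable (Pol : Finset (X → Fin K)) (ε δ : ℝ) (S : Transcript X K)

/-- The set `A_t` when the current sample is `Z`. -/
def setAt (Z : List (X × (Fin K → ℝ))) (t : ℕ) : Finset (Fin K) :=
  exploreSet Pol (threshold K Pol.card ε δ t) Z (S.pol t) (S.ctx t)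

/-- The estimated cost vector of round `t` when the current sample is `Z`: inverse propensity
scores of the observed loss on the explored actions, and `1` on the others. -/
def hatLossAt (Z : List (X × (Fin K → ℝ))) (t : ℕ) (a : Fin K) : ℝ :=
  if a ∈ setAt Pol ε δ S Z t then
    (if a = S.act t then
      S.loss t (S.act t) /
        playProb ε (setAt Pol ε δ S Z t) (S.pol t (S.ctx t)) (S.act t)
    else 0)
  else 1

/-- The sample the algorithm has built by the end of round `t`. -/
def hatSample : ℕ → List (X × (Fin K → ℝ))
  | 0 => []
  | t + 1 => hatSample t ++ [(S.ctx (t + 1), hatLossAt Pol ε δ S (hatSample t) (t + 1))]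

/-- The set `A_t` of explored actions at round `t ≥ 1`. -/
def explored (t : ℕ) : Finset (Fin K) := setAt Pol ε δ S (hatSample Pol ε δ S (t - 1)) t

/-- The distribution `p_t` of the action at round `t ≥ 1`. -/
def prob (t : ℕ) (a : Fin K) : ℝ :=
  playProb ε (explored Pol ε δ S t) (S.pol t (S.ctx t)) a

/-- The biased loss vector of round `t`: true losses on explored actions, `1` on the others. -/
def tildeLoss (t : ℕ) (a : Fin K) : ℝ := if a ∈ explored Pol ε δ S t then S.loss t a else 1

/-- The biased sample of rounds `1, …, T`. -/
def tildeSample (T : ℕ) : List (X × (Fin K → ℝ)) :=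
  (List.range T).map fun s => (S.ctx (s + 1), tildeLoss Pol ε δ S (s + 1))

/-- The (unobserved) true sample of rounds `1, …, T`. -/
def trueSample (T : ℕ) : List (X × (Fin K → ℝ)) :=
  (List.range T).map fun s => (S.ctx (s + 1), S.loss (s + 1))

/-- The regret `R_T` with respect to the policy `π`. -/
def regret (π : X → Fin K) (T : ℕ) : ℝ :=
  ∑ t ∈ Finset.Icc 1 T, (S.loss t (S.act t) - S.loss t (π (S.ctx t)))

end Transcript

end Algorithm

section Run

variable {X : Type*} [MeasurableSpace X] {K : ℕ} {Ω : Type*} [mΩ : MeasurableSpace Ω]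

/-- The random transcript `S` is a run of the active `ε`-greedy algorithm on the problem `B`.
The σ-algebra `𝓕 t` is the information at the end of round `t` (ties of the oracle may be broken
in any way that uses only the past). -/
structure IsRun (B : Problem X K) (ε δ : ℝ) (μ : Measure Ω) (𝓕 : Filtration ℕ mΩ)
    (S : Ω → Transcript X K) : Prop where
  ctx_meas : ∀ t, Measurable[𝓕 (t + 1)] fun ω => (S ω).ctx (t + 1)
  loss_meas : ∀ t, Measurable[𝓕 (t + 1)] fun ω => (S ω).loss (t + 1)
  act_meas : ∀ t, Measurable[𝓕 (t + 1)] fun ω => (S ω).act (t + 1)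
  /-- the pair `(x_t, ℓ_t)` is drawn from `D`, -/
  law : ∀ t, μ.map (fun ω => ((S ω).ctx (t + 1), (S ω).loss (t + 1))) = B.D
  /-- independently of the past; -/
  indep : ∀ t, Indep (MeasurableSpace.comap
    (fun ω => ((S ω).ctx (t + 1), (S ω).loss (t + 1))) inferInstance) (𝓕 t) μ
  /-- `π_t` is determined by the past, -/
  pol_meas : ∀ t, ∀ π ∈ B.Pol, MeasurableSet[𝓕 t] {ω | (S ω).pol (t + 1) = π}
  /-- and it minimizes the empirical loss on the sample built so far; -/
  pol_oracle : ∀ t ω, IsOracle B.Pol (fun _ => True)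
    (Transcript.hatSample B.Pol ε δ (S ω) t) ((S ω).pol (t + 1))
  /-- given the past, `x_t` and `ℓ_t`, the action `a_t` has distribution `p_t`. -/
  act_law : ∀ t a,
    μ[fun ω => if (S ω).act (t + 1) = a then (1 : ℝ) else 0 |
        𝓕 t ⊔ MeasurableSpace.comap
          (fun ω => ((S ω).ctx (t + 1), (S ω).loss (t + 1))) inferInstance]
      =ᵐ[μ] fun ω => Transcript.prob B.Pol ε δ (S ω) (t + 1) a

/-- The event `𝓔` that the deviation bounds hold for all policies and all `T ≥ 1`. -/
def goodEvent (B : Problem X K) (ε δ : ℝ) (S : Ω → Transcript X K) : Set Ω :=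
  {ω | ∀ π ∈ B.Pol, ∀ T : ℕ, 1 ≤ T →
    |(empLoss (Transcript.hatSample B.Pol ε δ (S ω) T) π
        - empLoss (Transcript.hatSample B.Pol ε δ (S ω) T) B.opt)
      - (empLoss (Transcript.tildeSample B.Pol ε δ (S ω) T) π
        - empLoss (Transcript.tildeSample B.Pol ε δ (S ω) T) B.opt)|
      ≤ Real.sqrt (2 * K * B.rho π B.opt * eT B.Pol.card δ T / ε)
        + (K / ε + 1) * eT B.Pol.card δ T ∧
    |(empLoss ((S ω).trueSample T) π - empLoss ((S ω).trueSample T) B.opt)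
      - (B.risk π - B.risk B.opt)|
      ≤ Real.sqrt (B.rho π B.opt * eT B.Pol.card δ T) + 2 * eT B.Pol.card δ T}

end Run

end ActiveGreedy

end

/-!
Given the past, the context and the loss vector of a round, the inverse propensity estimate is
unbiased for the losses of the explored actions. Its errors for `π` and `π*` differ by a random
variable of conditional second moment at most `2 K / ε`, which vanishes where `π` and `π*` agree.
Bernstein's inequality for martingale differences and a union bound over policies and times
therefore give the event `𝓔`.

While the deviation bounds hold, `π*` is never eliminated, because replacing the loss of an
unexplored action by `1` can only hurt its competitors. Put `q_n = K e_n / ε`. The Massart condition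
bounds the disagreement with `π*` by the excess risk over `τ`, which turns the deviation bound for
the policy of round `n + 1` into a quadratic inequality for its excess risk, of solution
`O(q_n / τ)`. Likewise every policy that keeps an action alive in that round is within
`O(√q_n / τ)` of `π*`, so the context lies in a disagreement region of probability
`O(θ √q_n / τ)`, and only there is another action played, with probability at most `ε`. The regret
of round `n + 1` is thus `O((q_n + ε θ √q_n) / τ)`; summing over the rounds gives the first bound,
and balancing its two terms in `ε` the second.

Conditioning on `𝓔` would destroy the independence of the rounds. In round `n + 1` the event `𝓔` is
therefore replaced by the event that the bounds hold up to time `n`, which belongs to the past and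
exceeds `𝓔` by probability `O(δ / n)` only.
-/

noncomputable section

namespace ActiveGreedy

section ExpBound

open Real

lemma hasDerivAt_quadratic_mul_exp_neg (k y : ℝ) :
    HasDerivAt (fun y => (1 + y + k * y ^ 2) * exp (-y))
      (y * (2 * k - 1 - k * y) * exp (-y)) y := by
  have hquad : HasDerivAt (fun y => 1 + y + k * y ^ 2) (1 + k * (2 * y)) y := by
    exact (((hasDerivAt_id y).const_add 1).add (((hasDerivAt_id y).pow 2).const_mul k)).congr_deriv
      (by simp)
  refine (hquad.mul (hasDerivAt_neg y).exp).congr_deriv ?_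
  ring

lemma exp_le_one_add_add_sq_div {c y : ℝ} (hc₀ : 0 ≤ c) (hc₁ : c < 1) (hy : y ≤ c) :
    exp y ≤ 1 + y + y ^ 2 / (2 * (1 - c)) := by
  set k := (2 * (1 - c))⁻¹ with hk
  have : 0 < k := inv_pos.2 (by linarith)
  have hkc : 2 * k - 1 = 2 * k * c := by
    have : 1 - c ≠ 0 := by linarith
    rw [hk]
    field_simp
    ring
  let g : ℝ → ℝ := fun y => (1 + y + k * y ^ 2) * exp (-y)
  have hderiv (y) : HasDerivAt g (y * (2 * k - 1 - k * y) * exp (-y)) y :=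
    hasDerivAt_quadratic_mul_exp_neg k y
  have hcont : Continuous g := continuous_iff_continuousAt.2 fun y => (hderiv y).continuousAt
  have hfactor (y) : 2 * k - 1 - k * y = k * (2 * c - y) := by rw [hkc]; ring
  -- On `(-∞, c]` the derivative of `g` has the sign of `y`, so `g` is minimal at `0`.
  have hmin : g 0 ≤ g y := by
    rcases le_total 0 y with h | h
    · refine monotoneOn_of_deriv_nonneg (convex_Icc 0 c) hcont.continuousOn
        (fun x _ => (hderiv x).differentiableAt.differentiableWithinAt) (fun x hx => ?_)
        ⟨le_rfl, hc₀⟩ ⟨h, hy⟩ h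
      rw [interior_Icc] at hx
      rw [(hderiv x).deriv, hfactor]
      have : 0 ≤ 2 * c - x := by linarith [hx.1, hx.2]
      have := hx.1.le
      positivity
    · refine antitoneOn_of_deriv_nonpos (convex_Iic 0) hcont.continuousOn
        (fun x _ => (hderiv x).differentiableAt.differentiableWithinAt) (fun x hx => ?_) h
        Set.self_mem_Iic h
      rw [interior_Iic] at hx
      rw [(hderiv x).deriv, hfactor]
      have : 0 ≤ 2 * c - x := by linarith [Set.mem_Iio.1 hx]
      exact mul_nonpos_of_nonpos_of_nonneg
        (mul_nonpos_of_nonpos_of_nonneg (le_of_lt hx) (by positivity)) (exp_pos _).le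
  calc exp y = g 0 * exp y := by simp [g]
    _ ≤ g y * exp y := by gcongr
    _ = 1 + y + y ^ 2 / (2 * (1 - c)) := by
      simp only [g]
      rw [mul_assoc, ← exp_add, neg_add_cancel, exp_zero, mul_one, hk, inv_mul_eq_div]

end ExpBound

section CondExp

variable {Ω : Type*} {m mΩ : MeasurableSpace Ω} {μ : Measure Ω} {W Y : Ω → ℝ} {b v C : ℝ}

lemma integral_mul_condExp [IsFiniteMeasure μ] (hm : m ≤ mΩ) (hW : Measurable[m] W)
    (hWb : ∀ᵐ ω ∂μ, |W ω| ≤ C) (hY : Integrable Y μ) :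
    ∫ ω, W ω * (μ[Y | m]) ω ∂μ = ∫ ω, W ω * Y ω ∂μ := by
  have hWY : Integrable (W * Y) μ :=
    hY.bdd_mul (hW.mono hm le_rfl).aestronglyMeasurable hWb
  calc ∫ ω, W ω * (μ[Y | m]) ω ∂μ = ∫ ω, (μ[W * Y | m]) ω ∂μ := integral_congr_ae
        (condExp_mul_of_stronglyMeasurable_left hW.stronglyMeasurable hWY hY).symm
    _ = ∫ ω, W ω * Y ω ∂μ := integral_condExp hm

lemma condExp_exp_mul_le [IsFiniteMeasure μ] (hm : m ≤ mΩ) (hY : Measurable Y)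
    (hYb : ∀ᵐ ω ∂μ, |Y ω| ≤ b) (hmean : μ[Y | m] =ᵐ[μ] 0)
    (hvar : μ[fun ω => Y ω ^ 2 | m] ≤ᵐ[μ] fun _ => v) {s : ℝ} (hs : 0 ≤ s) (hb : 0 ≤ b)
    (hsb : s * b < 1) :
    μ[fun ω => Real.exp (s * Y ω) | m]
      ≤ᵐ[μ] fun _ => Real.exp (s ^ 2 / (2 * (1 - s * b)) * v) := by
  set κ := s ^ 2 / (2 * (1 - s * b)) with hκ
  have : 0 ≤ κ := div_nonneg (sq_nonneg s) (by linarith)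
  have hYi : Integrable Y μ := .of_bound hY.aestronglyMeasurable b hYb
  have hY2i : Integrable (fun ω => Y ω ^ 2) μ := by
    refine .of_bound (hY.pow_const 2).aestronglyMeasurable (b ^ 2) ?_
    filter_upwards [hYb] with ω hω
    simpa using pow_le_pow_left₀ (abs_nonneg _) hω 2
  have hexp_le : ∀ᵐ ω ∂μ, Real.exp (s * Y ω) ≤ 1 + (s * Y ω + κ * Y ω ^ 2) := by
    filter_upwards [hYb] with ω hω
    have hsY : s * Y ω ≤ s * b := by gcongr; exact (le_abs_self _).trans hω
    refine (exp_le_one_add_add_sq_div (mul_nonneg hs hb) hsb hsY).trans_eq ?_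
    rw [hκ]
    ring
  have hexp : Integrable (fun ω => Real.exp (s * Y ω)) μ :=
    integrable_exp_mul_of_mem_Icc hY.aemeasurable (hYb.mono fun _ => abs_le.1)
  have hlin : Integrable (fun ω => s * Y ω) μ := hYi.const_mul s
  have hquad : Integrable (fun ω => κ * Y ω ^ 2) μ := hY2i.const_mul κ
  filter_upwards [condExp_mono (m := m) hexp ((integrable_const 1).add (hlin.add hquad)) hexp_le,
    condExp_add (integrable_const (μ := μ) (1 : ℝ)) (hlin.add hquad) m, condExp_add hlin hquad m,
    condExp_smul (μ := μ) s Y m, condExp_smul (μ := μ) κ (fun ω => Y ω ^ 2) m, hmean, hvar]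
    with ω h₁ h₂ h₃ h₄ h₅ h₆ h₇
  have hlin_eq : μ[fun ω => s * Y ω | m] ω = s * μ[Y | m] ω := h₄
  have hquad_eq : μ[fun ω => κ * Y ω ^ 2 | m] ω = κ * μ[fun ω => Y ω ^ 2 | m] ω := h₅
  calc μ[fun ω => Real.exp (s * Y ω) | m] ω
      ≤ 1 + (s * μ[Y | m] ω + κ * μ[fun ω => Y ω ^ 2 | m] ω) := by
        rw [← hlin_eq, ← hquad_eq]
        refine h₁.trans_eq (h₂.trans ?_)
        rw [Pi.add_apply, h₃, Pi.add_apply, condExp_const hm]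
    _ ≤ 1 + κ * v := by
        rw [h₆, Pi.zero_apply, mul_zero, zero_add]
        gcongr
    _ ≤ Real.exp (κ * v) := by linarith [Real.add_one_le_exp (κ * v)]

end CondExp

section Bernstein

variable {Ω : Type*} {mΩ : MeasurableSpace Ω} {μ : Measure Ω} {𝓕 : Filtration ℕ mΩ}
  {Y : ℕ → Ω → ℝ} {b v : ℝ}

/-- `Y` is a sequence of martingale differences that are bounded by `b` and have conditional second
moments at most `v`; `Y n` is revealed at time `n + 1`. -/
structure IsBoundedMartingaleDiff (μ : Measure Ω) (𝓕 : Filtration ℕ mΩ) (Y : ℕ → Ω → ℝ)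
    (b v : ℝ) : Prop where
  measurable_succ : ∀ n, Measurable[𝓕 (n + 1)] (Y n)
  ae_abs_le : ∀ n, ∀ᵐ ω ∂μ, |Y n ω| ≤ b
  condExp_eq_zero : ∀ n, μ[Y n | 𝓕 n] =ᵐ[μ] 0
  condExp_sq_le : ∀ n, μ[fun ω => Y n ω ^ 2 | 𝓕 n] ≤ᵐ[μ] fun _ => v

namespace IsBoundedMartingaleDiff

lemma neg (h : IsBoundedMartingaleDiff μ 𝓕 Y b v) :
    IsBoundedMartingaleDiff μ 𝓕 (fun n ω => -Y n ω) b v where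
  measurable_succ n := (h.measurable_succ n).neg
  ae_abs_le n := by simpa using h.ae_abs_le n
  condExp_eq_zero n := by
    filter_upwards [condExp_neg (μ := μ) (Y n) (𝓕 n), h.condExp_eq_zero n] with ω hneg hzero
    exact hneg.trans (by simp [hzero])
  condExp_sq_le n := by simpa using h.condExp_sq_le n

lemma measurable (h : IsBoundedMartingaleDiff μ 𝓕 Y b v) (n : ℕ) : Measurable (Y n) :=
  (h.measurable_succ n).mono (𝓕.le _) le_rfl

lemma measurable_sum (h : IsBoundedMartingaleDiff μ 𝓕 Y b v) (n : ℕ) :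
    Measurable[𝓕 n] fun ω => ∑ k ∈ Finset.range n, Y k ω :=
  Finset.measurable_fun_sum _ fun k hk =>
    (h.measurable_succ k).mono (𝓕.mono (Finset.mem_range.1 hk)) le_rfl

lemma abs_sum_le (h : IsBoundedMartingaleDiff μ 𝓕 Y b v) (n : ℕ) :
    ∀ᵐ ω ∂μ, |∑ k ∈ Finset.range n, Y k ω| ≤ n * b := by
  filter_upwards [ae_all_iff.2 h.ae_abs_le] with ω hω
  calc |∑ k ∈ Finset.range n, Y k ω| ≤ ∑ k ∈ Finset.range n, |Y k ω| :=
        Finset.abs_sum_le_sum_abs _ _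
    _ ≤ ∑ _k ∈ Finset.range n, b := Finset.sum_le_sum fun k _ => hω k
    _ = n * b := by simp

lemma abs_exp_sum_le (h : IsBoundedMartingaleDiff μ 𝓕 Y b v) {s : ℝ} (hs : 0 ≤ s) (n : ℕ) :
    ∀ᵐ ω ∂μ, |Real.exp (s * ∑ k ∈ Finset.range n, Y k ω)| ≤ Real.exp (s * (n * b)) := by
  filter_upwards [h.abs_sum_le n] with ω hω
  rw [Real.abs_exp]
  gcongr
  exact (le_abs_self _).trans hω

section IsFiniteMeasure

variable [IsFiniteMeasure μ]

lemma integrable_exp_sum (h : IsBoundedMartingaleDiff μ 𝓕 Y b v) (s : ℝ) (n : ℕ) :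
    Integrable (fun ω => Real.exp (s * ∑ k ∈ Finset.range n, Y k ω)) μ :=
  integrable_exp_mul_of_mem_Icc ((h.measurable_sum n).mono (𝓕.le n) le_rfl).aemeasurable
    ((h.abs_sum_le n).mono fun _ => abs_le.1)

lemma integral_exp_sum_succ_le (h : IsBoundedMartingaleDiff μ 𝓕 Y b v) {s : ℝ} (hs : 0 ≤ s)
    (hb : 0 ≤ b) (hsb : s * b < 1) (n : ℕ) :
    ∫ ω, Real.exp (s * ∑ k ∈ Finset.range (n + 1), Y k ω) ∂μ
      ≤ Real.exp (s ^ 2 / (2 * (1 - s * b)) * v)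
        * ∫ ω, Real.exp (s * ∑ k ∈ Finset.range n, Y k ω) ∂μ := by
  set W : Ω → ℝ := fun ω => Real.exp (s * ∑ k ∈ Finset.range n, Y k ω)
  have hW : Measurable[𝓕 n] W := ((h.measurable_sum n).const_mul s).exp
  have hexp : Integrable (fun ω => Real.exp (s * Y n ω)) μ :=
    integrable_exp_mul_of_mem_Icc (h.measurable n).aemeasurable
      ((h.ae_abs_le n).mono fun _ => abs_le.1)
  calc ∫ ω, Real.exp (s * ∑ k ∈ Finset.range (n + 1), Y k ω) ∂μ
      = ∫ ω, W ω * Real.exp (s * Y n ω) ∂μ := by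
        simp_rw [W, Finset.sum_range_succ, mul_add, Real.exp_add]
    _ = ∫ ω, W ω * μ[fun ω => Real.exp (s * Y n ω) | 𝓕 n] ω ∂μ :=
        (integral_mul_condExp (𝓕.le n) hW (h.abs_exp_sum_le hs n) hexp).symm
    _ ≤ ∫ ω, Real.exp (s ^ 2 / (2 * (1 - s * b)) * v) * W ω ∂μ := by
        refine integral_mono_ae (integrable_condExp.bdd_mul
          (hW.mono (𝓕.le n) le_rfl).aestronglyMeasurable (h.abs_exp_sum_le hs n))
          ((h.integrable_exp_sum s n).const_mul _) ?_
        filter_upwards [condExp_exp_mul_le (𝓕.le n) (h.measurable n) (h.ae_abs_le n)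
          (h.condExp_eq_zero n) (h.condExp_sq_le n) hs hb hsb] with ω hω
        rw [mul_comm _ (W ω)]
        exact mul_le_mul_of_nonneg_left hω (Real.exp_pos _).le
    _ = _ := integral_const_mul _ _

end IsFiniteMeasure

variable [IsProbabilityMeasure μ]

lemma integral_exp_sum_le (h : IsBoundedMartingaleDiff μ 𝓕 Y b v) {s : ℝ} (hs : 0 ≤ s)
    (hb : 0 ≤ b) (hsb : s * b < 1) (n : ℕ) :
    ∫ ω, Real.exp (s * ∑ k ∈ Finset.range n, Y k ω) ∂μ
      ≤ Real.exp (n * (s ^ 2 / (2 * (1 - s * b)) * v)) := by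
  induction n with
  | zero => simp
  | succ n ih =>
    refine (h.integral_exp_sum_succ_le hs hb hsb n).trans ?_
    rw [Nat.cast_succ, add_one_mul, add_comm, Real.exp_add]
    gcongr

lemma measureReal_le_sum_le_exp (h : IsBoundedMartingaleDiff μ 𝓕 Y b v) {s : ℝ} (hs : 0 ≤ s)
    (hb : 0 ≤ b) (hsb : s * b < 1) (n : ℕ) (x : ℝ) :
    μ.real {ω | x ≤ ∑ k ∈ Finset.range n, Y k ω}
      ≤ Real.exp (n * (s ^ 2 / (2 * (1 - s * b)) * v) - s * x) := by
  refine (measure_ge_le_exp_mul_mgf x hs (h.integrable_exp_sum s n)).trans ?_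
  rw [sub_eq_neg_add, Real.exp_add, neg_mul]
  gcongr
  exact h.integral_exp_sum_le hs hb hsb n

lemma measureReal_le_sum_le_exp_neg (h : IsBoundedMartingaleDiff μ 𝓕 Y b v) (hb : 0 ≤ b) (n : ℕ)
    {a : ℝ} (ha : 0 < a) (l : ℝ) :
    μ.real {ω | l / a + n * v * a / 2 + b * l ≤ ∑ k ∈ Finset.range n, Y k ω} ≤ Real.exp (-l) := by
  have hd : 0 < 1 + b * a := by positivity
  have hsb : 1 - a / (1 + b * a) * b = 1 / (1 + b * a) := by
    field_simp
    ring
  refine (h.measureReal_le_sum_le_exp (s := a / (1 + b * a)) (by positivity) hb ?_ n _).trans_eq ?_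
  · exact sub_pos.1 (hsb ▸ one_div_pos.2 hd)
  · rw [hsb]
    congr 1
    field_simp
    ring

/-- **Bernstein's inequality** for martingale differences. -/
theorem measureReal_sqrt_add_le_sum (h : IsBoundedMartingaleDiff μ 𝓕 Y b v) (hb : 0 < b)
    (hv : 0 ≤ v) {n : ℕ} (hn : n ≠ 0) {l : ℝ} (hl : 0 < l) :
    μ.real {ω | √(2 * n * v * l) + 2 * b * l ≤ ∑ k ∈ Finset.range n, Y k ω}
      ≤ Real.exp (-l) := by
  rcases hv.eq_or_lt with rfl | hv
  · convert h.measureReal_le_sum_le_exp_neg hb.le n (one_div_pos.2 hb) l using 5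
    simp
    ring
  · have : 0 < n * v := by positivity
    set a := √(2 * l / (n * v))
    have ha : 0 < a := Real.sqrt_pos.2 (by positivity)
    have hasq : a ^ 2 = 2 * l / (n * v) := Real.sq_sqrt (by positivity)
    have hsqrt : √(2 * n * v * l) = a * (n * v) := by
      rw [Real.sqrt_eq_iff_eq_sq (by positivity) (by positivity), mul_pow, hasq]
      field_simp
    have hopt : l / a + n * v * a / 2 = a * (n * v) := by
      have : l = a ^ 2 * (n * v) / 2 := by rw [hasq]; field_simp
      rw [this]
      field_simp
      ring
    refine (measureReal_mono fun ω hω => ?_).trans (h.measureReal_le_sum_le_exp_neg hb.le n ha l)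
    refine le_trans ?_ (Set.mem_ofPred.1 hω)
    rw [hopt, hsqrt]
    gcongr
    linarith

theorem measureReal_sqrt_add_le_abs_sum (h : IsBoundedMartingaleDiff μ 𝓕 Y b v) (hb : 0 < b)
    (hv : 0 ≤ v) {n : ℕ} (hn : n ≠ 0) {l : ℝ} (hl : 0 < l) :
    μ.real {ω | √(2 * n * v * l) + 2 * b * l ≤ |∑ k ∈ Finset.range n, Y k ω|}
      ≤ 2 * Real.exp (-l) := by
  have hunion := (measureReal_union_le (μ := μ) _ _).trans
    (add_le_add (h.measureReal_sqrt_add_le_sum hb hv hn hl)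
      (h.neg.measureReal_sqrt_add_le_sum hb hv hn hl))
  rw [← two_mul] at hunion
  refine (measureReal_mono fun ω hω => ?_).trans hunion
  simpa only [Set.mem_union, Set.mem_ofPred_eq, Finset.sum_neg_distrib] using le_abs.1 hω

end IsBoundedMartingaleDiff

end Bernstein

section InversePropensity

variable {ι : Type*} [DecidableEq ι] {p l : ι → ℝ} {η : ℝ}

/-- The inverse propensity estimate of the loss vector `l` when only the loss of the action `c` is
observed and `c` has been drawn from the distribution `p`. -/
def ipsEst (p l : ι → ℝ) (c a : ι) : ℝ := if a = c then l c / p c else 0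

/-- The estimation error of the inverse propensity estimate `ipsEst`. -/
def ipsErr (p l : ι → ℝ) (c a : ι) : ℝ := ipsEst p l c a - l a

lemma ipsEst_mem_Icc (hη : 0 < η) (hp : ∀ a, l a ≠ 0 → η ≤ p a)
    (hl : ∀ a, l a ∈ Set.Icc (0 : ℝ) 1) (c a : ι) : ipsEst p l c a ∈ Set.Icc 0 η⁻¹ := by
  by_cases h : a = c ∧ l c ≠ 0
  · have hpc : η ≤ p c := hp c h.2
    rw [ipsEst, if_pos h.1, inv_eq_one_div]
    exact ⟨div_nonneg (hl c).1 (hη.le.trans hpc), div_le_div₀ zero_le_one (hl c).2 hη hpc⟩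
  · have : ipsEst p l c a = 0 := by
      unfold ipsEst
      split_ifs with hac
      · rw [not_not.1 fun hlc => h ⟨hac, hlc⟩, zero_div]
      · rfl
    rw [this]
    exact ⟨le_rfl, inv_nonneg.2 hη.le⟩

lemma abs_ipsErr_sub_le (hη : 0 < η) (hp : ∀ a, l a ≠ 0 → η ≤ p a)
    (hl : ∀ a, l a ∈ Set.Icc (0 : ℝ) 1) (c a a' : ι) :
    |ipsErr p l c a - ipsErr p l c a'| ≤ η⁻¹ + 1 := by
  obtain ⟨ha₀, ha₁⟩ := ipsEst_mem_Icc hη hp hl c a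
  obtain ⟨ha'₀, ha'₁⟩ := ipsEst_mem_Icc hη hp hl c a'
  have hla := hl a
  have hla' := hl a'
  unfold ipsErr
  rw [abs_le]
  constructor <;> linarith [hla.1, hla.2, hla'.1, hla'.2]

variable [Fintype ι]

lemma sum_mul_ipsEst (hp : ∀ a, l a ≠ 0 → p a ≠ 0) (a : ι) :
    ∑ c, p c * ipsEst p l c a = l a := by
  simp only [ipsEst, mul_ite, mul_zero, Finset.sum_ite_eq, Finset.mem_univ, if_true]
  by_cases hla : l a = 0
  · simp [hla]
  · exact mul_div_cancel₀ (l a) (hp a hla)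

lemma sum_mul_ipsErr_sub (hsum : ∑ a, p a = 1) (hp : ∀ a, l a ≠ 0 → p a ≠ 0) (a a' : ι) :
    ∑ c, p c * (ipsErr p l c a - ipsErr p l c a') = 0 := by
  simp_rw [ipsErr, mul_sub, Finset.sum_sub_distrib, ← Finset.sum_mul, hsum, sum_mul_ipsEst hp,
    one_mul, sub_self]

lemma sum_mul_ipsEst_sq_le (hη : 0 < η) (hp : ∀ a, l a ≠ 0 → η ≤ p a)
    (hl : ∀ a, l a ∈ Set.Icc (0 : ℝ) 1) (a : ι) : ∑ c, p c * ipsEst p l c a ^ 2 ≤ η⁻¹ := by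
  have hp₀ : ∀ a, l a ≠ 0 → p a ≠ 0 := fun a ha => (hη.trans_le (hp a ha)).ne'
  calc ∑ c, p c * ipsEst p l c a ^ 2
      = ipsEst p l a a * ∑ c, p c * ipsEst p l c a := by
        rw [Finset.mul_sum]
        refine Finset.sum_congr rfl fun c _ => ?_
        by_cases hac : a = c
        · subst hac
          ring
        · simp [ipsEst, hac]
    _ = ipsEst p l a a * l a := by rw [sum_mul_ipsEst hp₀]
    _ ≤ η⁻¹ * 1 :=
        mul_le_mul (ipsEst_mem_Icc hη hp hl a a).2 (hl a).2 (hl a).1 (inv_nonneg.2 hη.le)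
    _ = η⁻¹ := mul_one _

lemma sum_mul_ipsErr_sub_sq_le (hsum : ∑ a, p a = 1) (hη : 0 < η)
    (hp : ∀ a, l a ≠ 0 → η ≤ p a) (hl : ∀ a, l a ∈ Set.Icc (0 : ℝ) 1) (a a' : ι) :
    ∑ c, p c * (ipsErr p l c a - ipsErr p l c a') ^ 2 ≤ 2 * η⁻¹ * if a ≠ a' then 1 else 0 := by
  by_cases haa' : a = a'
  · simp [haa']
  have hp₀ : ∀ a, l a ≠ 0 → p a ≠ 0 := fun a ha => (hη.trans_le (hp a ha)).ne'
  -- The cross term vanishes because at most one of two distinct actions is played.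
  have hexpand (c) : p c * (ipsErr p l c a - ipsErr p l c a') ^ 2
      = p c * ipsEst p l c a ^ 2 + p c * ipsEst p l c a' ^ 2
        - 2 * (l a - l a') * (p c * ipsEst p l c a - p c * ipsEst p l c a')
        + p c * (l a - l a') ^ 2 := by
    have hcross : ipsEst p l c a * ipsEst p l c a' = 0 := by
      by_cases hac : a = c
      · have : a' ≠ c := fun h => haa' (hac.trans h.symm)
        simp [ipsEst, this]
      · simp [ipsEst, hac]
    unfold ipsErr
    linear_combination (-2 * p c) * hcross
  rw [if_pos haa', mul_one]
  simp_rw [hexpand]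
  rw [Finset.sum_add_distrib, Finset.sum_sub_distrib, Finset.sum_add_distrib, ← Finset.mul_sum,
    Finset.sum_sub_distrib, ← Finset.sum_mul, hsum, sum_mul_ipsEst hp₀, sum_mul_ipsEst hp₀]
  linarith [sum_mul_ipsEst_sq_le hη hp hl a, sum_mul_ipsEst_sq_le hη hp hl a',
    sq_nonneg (l a - l a')]

end InversePropensity

section PlayProb

variable {K : ℕ} {ε : ℝ} {A : Finset (Fin K)} {a b : Fin K}

lemma playProb_of_notMem (hb : b ∈ A) (ha : a ∉ A) : playProb ε A b a = 0 := by
  rw [playProb, if_neg (ne_of_mem_of_not_mem hb ha).symm, if_neg ha]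

lemma div_le_playProb (hε : 0 ≤ ε) (hε1 : ε ≤ 1) (ha : a ∈ A) : ε / K ≤ playProb ε A b a := by
  have : (0 : ℝ) < K := by exact_mod_cast a.pos
  by_cases hab : a = b
  · have hA : (A.card : ℝ) ≤ K := by exact_mod_cast card_finset_fin_le A
    have hsplit : ((K : ℝ) - 1) * ε / K + ε / K = ε := by
      field_simp
      ring
    have : ((A.card : ℝ) - 1) * ε / K ≤ (K - 1) * ε / K := by gcongr
    rw [playProb, if_pos hab]
    linarith
  · rw [playProb, if_neg hab, if_pos ha]

lemma sum_playProb (hb : b ∈ A) : ∑ a, playProb ε A b a = 1 := by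
  have hrest : ∑ a ∈ A.erase b, playProb ε A b a = (A.card - 1) * (ε / K) := by
    rw [Finset.sum_congr rfl fun a ha => show playProb ε A b a = ε / K by
        rw [playProb, if_neg (Finset.ne_of_mem_erase ha), if_pos (Finset.mem_of_mem_erase ha)],
      Finset.sum_const, nsmul_eq_mul, Finset.cast_card_erase_of_mem hb]
  rw [← Finset.sum_subset (Finset.subset_univ A) fun a _ ha => playProb_of_notMem hb ha,
    ← Finset.add_sum_erase A _ hb, hrest, playProb, if_pos rfl]
  ring

lemma one_sub_playProb_self_le (hε : 0 ≤ ε) (hb : b ∈ A) :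
    1 - playProb ε A b b ≤ if ∃ a ∈ A, a ≠ b then ε else 0 := by
  have hself : 1 - playProb ε A b b = ((A.card : ℝ) - 1) * ε / K := by simp [playProb]
  rw [hself]
  split_ifs with h
  · have hK : (0 : ℝ) < K := by exact_mod_cast b.pos
    have hA : (A.card : ℝ) ≤ K := by exact_mod_cast card_finset_fin_le A
    rw [div_le_iff₀ hK, mul_comm ε]
    gcongr
    linarith
  · push Not at h
    simp [Finset.eq_singleton_iff_unique_mem.2 ⟨hb, h⟩]

end PlayProb

section EmpiricalLoss

variable {X : Type*} {K : ℕ}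

lemma empLoss_map_range (T : ℕ) (f : ℕ → X × (Fin K → ℝ)) (π : X → Fin K) :
    empLoss ((List.range T).map f) π = (∑ s ∈ Finset.range T, (f s).2 (π (f s).1)) / T := by
  rw [empLoss, List.map_map, List.length_map, List.length_range]
  rfl

lemma mem_exploreSet_iff {Pol : Finset (X → Fin K)} {Δ : ℝ} {Z : List (X × (Fin K → ℝ))}
    {πt : X → Fin K} (hπt : IsOracle Pol (fun _ => True) Z πt) {x : X} {a : Fin K} :
    a ∈ exploreSet Pol Δ Z πt x ↔
      ∃ π ∈ Pol, π x = a ∧ ∀ π' ∈ Pol, empLoss Z π - empLoss Z π' ≤ Δ := by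
  classical
  simp only [exploreSet, Finset.mem_filter, Finset.mem_univ, true_and]
  constructor
  · rintro ⟨π, ⟨hπ, hπx, -⟩, hle⟩
    exact ⟨π, hπ, hπx, fun π' hπ' => by linarith [hπt.2.2 π' hπ' trivial]⟩
  · rintro ⟨π, hπ, hπx, hle⟩
    have hπ_mem : π ∈ Pol.filter fun π' => π' x = a := Finset.mem_filter.2 ⟨hπ, hπx⟩
    obtain ⟨π₀, hπ₀, hmin⟩ := Finset.exists_min_image _ (empLoss Z) ⟨π, hπ_mem⟩
    rw [Finset.mem_filter] at hπ₀
    refine ⟨π₀, ⟨hπ₀.1, hπ₀.2, fun π' hπ' hπ'x => hmin π' (Finset.mem_filter.2 ⟨hπ', hπ'x⟩)⟩, ?_⟩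
    linarith [hmin π hπ_mem, hle πt hπt.1]

namespace Transcript

variable (Pol : Finset (X → Fin K)) (ε δ : ℝ) (S : Transcript X K)

/-- The estimated cost vector `ℓ̂_t` of round `t ≥ 1`. -/
def hatLoss (t : ℕ) : Fin K → ℝ := hatLossAt Pol ε δ S (hatSample Pol ε δ S (t - 1)) t

/-- The loss vector of round `t`, set to `0` (rather than to `1`, as in `tildeLoss`) outside the
explored actions. With this convention `ℓ̂_t - ℓ̃_t` is an inverse propensity error. -/
def exploredLoss (t : ℕ) (a : Fin K) : ℝ := if a ∈ explored Pol ε δ S t then S.loss t a else 0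

lemma hatSample_eq_map (T : ℕ) : hatSample Pol ε δ S T
    = (List.range T).map fun s => (S.ctx (s + 1), hatLoss Pol ε δ S (s + 1)) := by
  induction T with
  | zero => rfl
  | succ T ih =>
    rw [hatSample, List.range_succ, List.map_append, ← ih]
    rfl

lemma empLoss_hatSample (T : ℕ) (π : X → Fin K) : empLoss (hatSample Pol ε δ S T) π
    = (∑ s ∈ Finset.range T, hatLoss Pol ε δ S (s + 1) (π (S.ctx (s + 1)))) / T := by
  rw [hatSample_eq_map, empLoss_map_range]

lemma empLoss_tildeSample (T : ℕ) (π : X → Fin K) : empLoss (tildeSample Pol ε δ S T) π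
    = (∑ s ∈ Finset.range T, tildeLoss Pol ε δ S (s + 1) (π (S.ctx (s + 1)))) / T :=
  empLoss_map_range T _ π

lemma empLoss_trueSample (T : ℕ) (π : X → Fin K) : empLoss (trueSample S T) π
    = (∑ s ∈ Finset.range T, S.loss (s + 1) (π (S.ctx (s + 1)))) / T :=
  empLoss_map_range T _ π

lemma hatLoss_sub_tildeLoss (t : ℕ) (a : Fin K) :
    hatLoss Pol ε δ S t a - tildeLoss Pol ε δ S t a
      = ipsErr (prob Pol ε δ S t) (exploredLoss Pol ε δ S t) (S.act t) a := by
  unfold hatLoss hatLossAt tildeLoss ipsErr ipsEst exploredLoss prob explored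
  split_ifs <;> simp_all

end Transcript

end EmpiricalLoss

section ConfidenceWidth

variable {K N : ℕ} {ε δ : ℝ}

lemma two_mul_div_deltaT (N : ℕ) {T : ℕ} (hT : T ≠ 0) :
    2 * N / deltaT δ T = 2 * N * (T * (T + 1)) / δ := by
  rcases eq_or_ne δ 0 with rfl | hδ
  · simp [deltaT]
  · unfold deltaT
    field_simp

section

variable (hN : 1 ≤ N) (hδ : 0 < δ) (hδ1 : δ < 1)

include hN hδ hδ1

lemma two_mul_mul_succ_le_div_deltaT {T : ℕ} (hT : T ≠ 0) :
    2 * ((T : ℝ) * (T + 1)) ≤ 2 * N / deltaT δ T := by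
  have hN' : (1 : ℝ) ≤ N := by exact_mod_cast hN
  rw [two_mul_div_deltaT N hT, le_div_iff₀ hδ]
  calc 2 * ((T : ℝ) * (T + 1)) * δ ≤ 2 * ((T : ℝ) * (T + 1)) * N := by gcongr; linarith
    _ = 2 * N * (T * (T + 1)) := by ring

lemma one_le_log_div_deltaT {T : ℕ} (hT : T ≠ 0) : 1 ≤ Real.log (2 * N / deltaT δ T) := by
  have hT' : (1 : ℝ) ≤ T := by exact_mod_cast Nat.one_le_iff_ne_zero.2 hT
  have hfour : (4 : ℝ) ≤ 2 * N / deltaT δ T := by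
    nlinarith [two_mul_mul_succ_le_div_deltaT hN hδ hδ1 hT]
  rw [Real.le_log_iff_exp_le (by linarith)]
  linarith [Real.exp_one_lt_d9]

lemma two_div_le_eT (T : ℕ) : 2 / (T : ℝ) ≤ eT N δ T := by
  rcases eq_or_ne T 0 with rfl | hT
  · simp [eT]
  · unfold eT
    gcongr
    linarith [one_le_log_div_deltaT hN hδ hδ1 hT]

lemma eT_nonneg (T : ℕ) : 0 ≤ eT N δ T :=
  (by positivity : (0 : ℝ) ≤ 2 / T).trans (two_div_le_eT hN hδ hδ1 T)

lemma one_le_eT_of_le_three {T : ℕ} (hT : T ≠ 0) (hT3 : T ≤ 3) : 1 ≤ eT N δ T := by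
  rcases hT3.eq_or_lt with rfl | hT3
  · have hlog : (2 : ℝ) ≤ Real.log (2 * N / deltaT δ 3) := by
      have hle : (24 : ℝ) ≤ 2 * N / deltaT δ 3 := by
        have := two_mul_mul_succ_le_div_deltaT hN hδ hδ1 hT
        norm_num at this ⊢
        exact this
      have hexp : Real.exp 2 = Real.exp 1 ^ 2 := by rw [← Real.exp_nat_mul]; norm_num
      rw [Real.le_log_iff_exp_le (by linarith), hexp]
      nlinarith [Real.exp_one_lt_d9, Real.exp_pos 1]
    unfold eT
    push_cast
    linarith
  · refine le_trans ?_ (two_div_le_eT hN hδ hδ1 T)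
    have hT' : (0 : ℝ) < T := by positivity
    rw [one_le_div₀ hT']
    exact_mod_cast Nat.lt_succ_iff.1 hT3

lemma eT_le_of_lt {n T : ℕ} (hn : n ≠ 0) (hT : n < T) :
    eT N δ n ≤ 6 * Real.log (T * N / δ) / n := by
  have hN' : (1 : ℝ) ≤ N := by exact_mod_cast hN
  have hn' : (1 : ℝ) ≤ n := by exact_mod_cast Nat.one_le_iff_ne_zero.2 hn
  have hT' : (n : ℝ) + 1 ≤ T := by exact_mod_cast hT
  have hcube : 2 * N / deltaT δ n ≤ (T * N / δ) ^ 3 := by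
    rw [two_mul_div_deltaT N hn, div_pow]
    have hδ3 : δ ^ 3 ≤ δ := pow_le_of_le_one hδ.le hδ1.le (by norm_num)
    have hN3 : (N : ℝ) ≤ N ^ 3 := le_self_pow₀ hN' (by norm_num)
    gcongr
    calc 2 * (N : ℝ) * (n * (n + 1)) ≤ T * N ^ 3 * (T * T) := by gcongr; linarith
      _ = (T * N : ℝ) ^ 3 := by ring
  have hpos : 0 < 2 * N / deltaT δ n :=
    lt_of_lt_of_le (by positivity) (two_mul_mul_succ_le_div_deltaT hN hδ hδ1 hn)
  have hlog := Real.log_le_log hpos hcube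
  rw [Real.log_pow, Nat.cast_ofNat] at hlog
  exact div_le_div_of_nonneg_right (by linarith) n.cast_nonneg

end

/-- The sum of the two deviation widths in the event `𝓔`, at sample size `T`, for a policy at
distance `ρ` of the optimal one. -/
def devWidth (K N : ℕ) (ε δ : ℝ) (T : ℕ) (ρ : ℝ) : ℝ :=
  √(2 * K * ρ * eT N δ T / ε) + (K / ε + 1) * eT N δ T + (√(ρ * eT N δ T) + 2 * eT N δ T)

lemma threshold_succ (K N : ℕ) (hε : 0 ≤ ε) (δ : ℝ) (n : ℕ) :
    threshold K N ε δ (n + 1) = devWidth K N ε δ n 1 := by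
  have : (2 * K * 1 * eT N δ n / ε : ℝ) = 2 * K / ε * eT N δ n := by ring
  unfold threshold devWidth
  rw [Nat.add_sub_cancel, this, Real.sqrt_mul (by positivity)]
  ring_nf

section

variable (hN : 1 ≤ N) (hε : 0 < ε) (hδ : 0 < δ) (hδ1 : δ < 1) (n : ℕ)

include hN hε hδ hδ1

lemma monotone_devWidth (K : ℕ) : Monotone (devWidth K N ε δ n) := by
  intro ρ ρ' h
  have := eT_nonneg hN hδ hδ1 n
  unfold devWidth
  gcongr

lemma devWidth_nonneg (K : ℕ) (ρ : ℝ) : 0 ≤ devWidth K N ε δ n ρ := by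
  have := eT_nonneg hN hδ hδ1 n
  unfold devWidth
  positivity

lemma devWidth_le (hK : 1 ≤ K) (hε1 : ε ≤ 1) {ρ : ℝ} (hρ : 0 ≤ ρ) :
    devWidth K N ε δ n ρ ≤ 3 * √(ρ * (K * eT N δ n / ε)) + 4 * (K * eT N δ n / ε) := by
  have he := eT_nonneg hN hδ hδ1 n
  unfold devWidth
  set e := eT N δ n
  set q : ℝ := K * e / ε
  have heq : e ≤ q := by
    have hK' : (1 : ℝ) ≤ K := by exact_mod_cast hK
    rw [le_div_iff₀ hε]
    nlinarith
  have hips : √(2 * K * ρ * e / ε) ≤ 3 / 2 * √(ρ * q) := by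
    have hsqrt2 : √2 ≤ 3 / 2 := by rw [Real.sqrt_le_left (by norm_num)]; norm_num
    rw [show 2 * K * ρ * e / ε = 2 * (ρ * q) by ring, Real.sqrt_mul (by norm_num)]
    gcongr
  have htrue : √(ρ * e) ≤ √(ρ * q) := by gcongr
  have hq : (K / ε + 1) * e = q + e := by ring
  linarith [Real.sqrt_nonneg (ρ * q)]

end

lemma le_of_le_sqrt_mul_add {x ρ q τ : ℝ} (hρ : 0 ≤ ρ) (hq : 0 ≤ q) (hτ : 0 < τ) (hτ1 : τ ≤ 1)
    (hx : x ≤ 3 * √(ρ * q) + 4 * q) (hρx : ρ ≤ 1 / τ * x) : x ≤ 17 / τ * q := by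
  -- AM-GM: `3 √(ρ q) = √((τ ρ) (9 q / τ)) ≤ (τ ρ + 9 q / τ) / 2`
  have hamgm : 3 * √(ρ * q) ≤ (τ * ρ + 9 * (q / τ)) / 2 := by
    have hsq : τ * ρ * (9 * (q / τ)) = 3 ^ 2 * (ρ * q) := by field_simp; ring
    calc 3 * √(ρ * q) = √(τ * ρ * (9 * (q / τ))) := by
          rw [hsq, Real.sqrt_mul (by positivity) (ρ * q), Real.sqrt_sq (by norm_num)]
      _ ≤ (τ * ρ + 9 * (q / τ)) / 2 := by
          refine Real.sqrt_le_iff.2 ⟨by positivity, ?_⟩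
          nlinarith [sq_nonneg (τ * ρ - 9 * (q / τ))]
  have hτρ : τ * ρ ≤ x := by
    calc τ * ρ ≤ τ * (1 / τ * x) := by gcongr
      _ = x := by field_simp
  have hqτ : q ≤ q / τ := le_div_self hq hτ hτ1
  calc x ≤ 17 * (q / τ) := by linarith
    _ = 17 / τ * q := by ring

end ConfidenceWidth

section GoodPath

variable {X : Type*} [MeasurableSpace X] {K : ℕ}

namespace Problem

variable (B : Problem X K)

instance : IsProbabilityMeasure B.D := B.isProb

instance : IsProbabilityMeasure B.ctxLaw :=
  Measure.isProbabilityMeasure_map measurable_fst.aemeasurable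

lemma one_le_numActions (B : Problem X K) : 1 ≤ K := by
  obtain ⟨z⟩ := nonempty_of_isProbabilityMeasure B.D
  exact (B.opt z.1).pos

lemma one_le_card : 1 ≤ B.Pol.card := Finset.card_pos.2 ⟨_, B.opt_mem⟩

lemma rho_nonneg (π π' : X → Fin K) : 0 ≤ B.rho π π' := measureReal_nonneg

lemma rho_le_one (π π' : X → Fin K) : B.rho π π' ≤ 1 := measureReal_le_one

lemma risk_opt_le {π : X → Fin K} (hπ : π ∈ B.Pol) : B.risk B.opt ≤ B.risk π := B.opt_min π hπ

end Problem

/-- The two deviation bounds of the event `𝓔` at time `T`, for all policies. -/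
def DevBound (B : Problem X K) (ε δ : ℝ) (S : Transcript X K) (T : ℕ) : Prop :=
  ∀ π ∈ B.Pol,
    |(empLoss (S.hatSample B.Pol ε δ T) π - empLoss (S.hatSample B.Pol ε δ T) B.opt)
      - (empLoss (S.tildeSample B.Pol ε δ T) π - empLoss (S.tildeSample B.Pol ε δ T) B.opt)|
      ≤ √(2 * K * B.rho π B.opt * eT B.Pol.card δ T / ε) + (K / ε + 1) * eT B.Pol.card δ T ∧
    |(empLoss (S.trueSample T) π - empLoss (S.trueSample T) B.opt)
      - (B.risk π - B.risk B.opt)|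
      ≤ √(B.rho π B.opt * eT B.Pol.card δ T) + 2 * eT B.Pol.card δ T

/-- The deviation bounds at all times `1, …, n`: what the algorithm needs in round `n + 1`. Unlike
the event `𝓔` itself, this is decided by the first `n` rounds. -/
def DevBoundUpTo (B : Problem X K) (ε δ : ℝ) (S : Transcript X K) (n : ℕ) : Prop :=
  ∀ T, 1 ≤ T → T ≤ n → DevBound B ε δ S T

lemma goodEvent_eq {Ω : Type*} (B : Problem X K) (ε δ : ℝ) (S : Ω → Transcript X K) :
    goodEvent B ε δ S = {ω | ∀ T, 1 ≤ T → DevBound B ε δ (S ω) T} :=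
  Set.ext fun _ => ⟨fun h T hT π hπ => h π hπ T hT, fun h π hπ T hT => h T hT π hπ⟩

lemma goodEvent_subset_devBoundUpTo {Ω : Type*} (B : Problem X K) (ε δ : ℝ)
    (S : Ω → Transcript X K) (n : ℕ) : goodEvent B ε δ S ⊆ {ω | DevBoundUpTo B ε δ (S ω) n} := by
  rw [goodEvent_eq]
  exact fun ω hω T hT _ => hω T hT

/-- The rules of the game that hold almost surely in a run: the losses lie in `[0, 1]`, and the
policy of each round minimizes the empirical loss on the sample built so far. -/
structure IsExecution (B : Problem X K) (ε δ : ℝ) (S : Transcript X K) : Prop where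
  loss_mem : ∀ t a, S.loss (t + 1) a ∈ Set.Icc (0 : ℝ) 1
  isOracle : ∀ t, IsOracle B.Pol (fun _ => True) (S.hatSample B.Pol ε δ t) (S.pol (t + 1))

variable {B : Problem X K} {ε δ τ : ℝ} {S : Transcript X K} {n : ℕ}

lemma mem_explored_succ_iff
    (h : IsOracle B.Pol (fun _ => True) (S.hatSample B.Pol ε δ n) (S.pol (n + 1))) {a : Fin K} :
    a ∈ S.explored B.Pol ε δ (n + 1) ↔ ∃ π ∈ B.Pol, π (S.ctx (n + 1)) = a ∧ ∀ π' ∈ B.Pol,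
      empLoss (S.hatSample B.Pol ε δ n) π - empLoss (S.hatSample B.Pol ε δ n) π'
        ≤ threshold K B.Pol.card ε δ (n + 1) :=
  mem_exploreSet_iff h

lemma pol_mem_explored (hε : 0 < ε) (hδ : 0 < δ) (hδ1 : δ < 1)
    (h : IsOracle B.Pol (fun _ => True) (S.hatSample B.Pol ε δ n) (S.pol (n + 1))) :
    S.pol (n + 1) (S.ctx (n + 1)) ∈ S.explored B.Pol ε δ (n + 1) := by
  refine (mem_explored_succ_iff h).2 ⟨_, h.1, rfl, fun π' hπ' => ?_⟩
  rw [threshold_succ _ _ hε.le]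
  linarith [h.2.2 π' hπ' trivial, devWidth_nonneg B.one_le_card hε hδ hδ1 n K 1]

namespace IsExecution

variable (h : IsExecution B ε δ S)

include h

-- Replacing an unexplored loss by `1` can only hurt the competitors of `π*`.
lemma trueSample_sub_le_tildeSample_sub
    (hopt : ∀ s < n, B.opt (S.ctx (s + 1)) ∈ S.explored B.Pol ε δ (s + 1)) (π : X → Fin K) :
    empLoss (S.trueSample n) π - empLoss (S.trueSample n) B.opt
      ≤ empLoss (S.tildeSample B.Pol ε δ n) π - empLoss (S.tildeSample B.Pol ε δ n) B.opt := by
  simp_rw [Transcript.empLoss_trueSample, Transcript.empLoss_tildeSample, ← sub_div,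
    ← Finset.sum_sub_distrib, Transcript.tildeLoss]
  gcongr with s hs
  · split_ifs
    · exact le_rfl
    · exact (h.loss_mem _ _).2
  · rw [if_pos (hopt s (Finset.mem_range.1 hs))]

lemma risk_sub_le (hopt : ∀ s < n, B.opt (S.ctx (s + 1)) ∈ S.explored B.Pol ε δ (s + 1))
    (hdev : DevBound B ε δ S n) {π : X → Fin K} (hπ : π ∈ B.Pol) :
    B.risk π - B.risk B.opt ≤ empLoss (S.hatSample B.Pol ε δ n) π
      - empLoss (S.hatSample B.Pol ε δ n) B.opt
      + devWidth K B.Pol.card ε δ n (B.rho π B.opt) := by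
  obtain ⟨hhat, htrue⟩ := hdev π hπ
  unfold devWidth
  linarith [h.trueSample_sub_le_tildeSample_sub hopt π, (abs_le.1 hhat).1, (abs_le.1 htrue).1]

variable (hε : 0 < ε) (hδ : 0 < δ) (hδ1 : δ < 1)

include hε hδ hδ1

lemma opt_mem_explored (hdev : DevBoundUpTo B ε δ S n) :
    ∀ m ≤ n, B.opt (S.ctx (m + 1)) ∈ S.explored B.Pol ε δ (m + 1) := by
  intro m
  induction m using Nat.strong_induction_on with
  | _ m ih =>
    intro hm
    refine (mem_explored_succ_iff (h.isOracle m)).2 ⟨_, B.opt_mem, rfl, fun π' hπ' => ?_⟩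
    rw [threshold_succ _ _ hε.le]
    rcases Nat.eq_zero_or_pos m with rfl | hm0
    · simpa [Transcript.hatSample, empLoss] using devWidth_nonneg B.one_le_card hε hδ hδ1 0 K 1
    · have hrisk := h.risk_sub_le (fun s hs => ih s hs (by omega)) (hdev m hm0 hm) hπ'
      have hmono := monotone_devWidth B.one_le_card hε hδ hδ1 m K (B.rho_le_one π' B.opt)
      linarith [B.risk_opt_le hπ']

variable (hε1 : ε ≤ 1) (hτ : B.Massart τ) (hn : 1 ≤ n) (hdev : DevBoundUpTo B ε δ S n)

include hε1 hτ hn hdev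

lemma risk_pol_sub_le (hτ1 : τ ≤ 1) :
    B.risk (S.pol (n + 1)) - B.risk B.opt ≤ 17 / τ * (K * eT B.Pol.card δ n / ε) := by
  have hopt := h.opt_mem_explored hε hδ hδ1 hdev
  obtain ⟨hpol, -, hmin⟩ := h.isOracle n
  have hrisk := h.risk_sub_le (fun s hs => hopt s hs.le) (hdev n hn le_rfl) hpol
  have hwidth := devWidth_le B.one_le_card hε hδ hδ1 n B.one_le_numActions hε1
    (B.rho_nonneg (S.pol (n + 1)) B.opt)
  have := eT_nonneg B.one_le_card hδ hδ1 n
  exact le_of_le_sqrt_mul_add (B.rho_nonneg _ _) (by positivity) hτ.1 hτ1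
    (by linarith [hmin _ B.opt_mem trivial]) (hτ.2 _ hpol)

variable (hq : K * eT B.Pol.card δ n / ε ≤ 1)

include hq

lemma rho_le_of_empLoss_sub_le {π : X → Fin K} (hπ : π ∈ B.Pol)
    (hle : empLoss (S.hatSample B.Pol ε δ n) π - empLoss (S.hatSample B.Pol ε δ n) B.opt
      ≤ threshold K B.Pol.card ε δ (n + 1)) :
    B.rho π B.opt ≤ 14 / τ * √(K * eT B.Pol.card δ n / ε) := by
  have hopt := h.opt_mem_explored hε hδ hδ1 hdev
  have he := eT_nonneg B.one_le_card hδ hδ1 n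
  have hrisk := h.risk_sub_le (fun s hs => hopt s hs.le) (hdev n hn le_rfl) hπ
  have hmono := monotone_devWidth B.one_le_card hε hδ hδ1 n K (B.rho_le_one π B.opt)
  have hwidth := devWidth_le B.one_le_card hε hδ hδ1 n B.one_le_numActions hε1 zero_le_one
  rw [threshold_succ _ _ hε.le] at hle
  rw [one_mul] at hwidth
  have hsqrt : K * eT B.Pol.card δ n / ε ≤ √(K * eT B.Pol.card δ n / ε) :=
    Real.le_sqrt_of_sq_le (pow_le_of_le_one (by positivity) hq two_ne_zero)
  have := hτ.1
  calc B.rho π B.opt ≤ 1 / τ * (B.risk π - B.risk B.opt) := hτ.2 π hπ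
    _ ≤ 1 / τ * (14 * √(K * eT B.Pol.card δ n / ε)) := by gcongr; linarith
    _ = 14 / τ * √(K * eT B.Pol.card δ n / ε) := by ring

lemma ctx_mem_disRegion
    (hne : ∃ a ∈ S.explored B.Pol ε δ (n + 1), a ≠ S.pol (n + 1) (S.ctx (n + 1))) :
    S.ctx (n + 1) ∈ B.disRegion (14 / τ * √(K * eT B.Pol.card δ n / ε)) := by
  -- Of two distinct explored actions, at least one differs from the optimal one.
  obtain ⟨a, ha, hne_opt⟩ : ∃ a ∈ S.explored B.Pol ε δ (n + 1), a ≠ B.opt (S.ctx (n + 1)) := by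
    obtain ⟨a, ha, hne⟩ := hne
    by_cases hopt : a = B.opt (S.ctx (n + 1))
    · exact ⟨_, pol_mem_explored hε hδ hδ1 (h.isOracle n), hopt ▸ hne.symm⟩
    · exact ⟨a, ha, hopt⟩
  obtain ⟨π, hπ, hπa, hle⟩ := (mem_explored_succ_iff (h.isOracle n)).1 ha
  exact ⟨π, hπ, h.rho_le_of_empLoss_sub_le hε hδ hδ1 hε1 hτ hn hdev hq hπ (hle _ B.opt_mem),
    by rwa [hπa]⟩

end IsExecution

end GoodPath

section Measurability

variable {Ω : Type*} {m : MeasurableSpace Ω}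

lemma measurable_apply_of_countable {ι β : Type*} [Countable ι] [MeasurableSpace ι]
    [MeasurableSingletonClass ι] [MeasurableSpace β] {f : ι → Ω → β} {g : Ω → ι}
    (hf : ∀ i, Measurable (f i)) (hg : Measurable g) : Measurable fun ω => f (g ω) ω :=
  (measurable_from_prod_countable_right (f := fun x : ι × Ω => f x.1 x.2) hf).comp
    (hg.prodMk measurable_id)

lemma measurable_ipsErr {ι : Type*} [DecidableEq ι] {p l : Ω → ι → ℝ}
    (hp : ∀ a, Measurable fun ω => p ω a) (hl : ∀ a, Measurable fun ω => l ω a) (c a : ι) :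
    Measurable fun ω => ipsErr (p ω) (l ω) c a := by
  unfold ipsErr ipsEst
  refine Measurable.sub ?_ (hl a)
  split_ifs
  · exact (hl c).div (hp c)
  · exact measurable_const

variable {K : ℕ} {A : Ω → Finset (Fin K)} {b : Ω → Fin K}

lemma measurable_playProb (ε : ℝ) (hA : ∀ a, MeasurableSet {ω | a ∈ A ω}) (hb : Measurable b)
    (c : Fin K) : Measurable fun ω => playProb ε (A ω) (b ω) c := by
  have hcard : Measurable fun ω => ((A ω).card : ℝ) := by
    have : (fun ω => ((A ω).card : ℝ)) = fun ω => ∑ a, if a ∈ A ω then (1 : ℝ) else 0 := by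
      ext ω; simp
    rw [this]
    exact Finset.measurable_sum _ fun a _ =>
      Measurable.ite (hA a) measurable_const measurable_const
  exact Measurable.ite (measurableSet_eq_fun measurable_const hb)
    (measurable_const.sub (((hcard.sub_const 1).mul_const ε).div_const _))
    (Measurable.ite (hA c) measurable_const measurable_const)

end Measurability

namespace Problem

variable {X : Type*} [MeasurableSpace X] {K : ℕ} (B : Problem X K)

/-- The excess loss of the policy `π` over the optimal policy on one example. -/
def excess (π : X → Fin K) (z : X × (Fin K → ℝ)) : ℝ := z.2 (π z.1) - z.2 (B.opt z.1)

/-- The indicator, as a real number, of a disagreement of `π` with the optimal policy. -/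
def disagree (π : X → Fin K) (z : X × (Fin K → ℝ)) : ℝ := if π z.1 ≠ B.opt z.1 then 1 else 0

lemma disagree_le_one (π : X → Fin K) (z : X × (Fin K → ℝ)) : B.disagree π z ≤ 1 := by
  unfold disagree; split_ifs <;> norm_num

lemma disagree_nonneg (π : X → Fin K) (z : X × (Fin K → ℝ)) : 0 ≤ B.disagree π z := by
  unfold disagree; split_ifs <;> norm_num

lemma abs_excess_le_disagree (π : X → Fin K) : ∀ᵐ z ∂B.D, |B.excess π z| ≤ B.disagree π z := by
  filter_upwards [B.loss_mem] with z hz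
  unfold excess disagree
  split_ifs with hne
  · simpa using abs_sub_le_of_le_of_le (hz _).1 (hz _).2 (hz _).1 (hz _).2
  · rw [not_not.1 hne, sub_self, abs_zero]

variable {B} {π : X → Fin K} (hπ : π ∈ B.Pol)

include hπ

lemma measurable_loss_apply : Measurable fun z : X × (Fin K → ℝ) => z.2 (π z.1) :=
  measurable_apply_of_countable (f := fun a (z : X × (Fin K → ℝ)) => z.2 a)
    (fun a => (measurable_pi_apply a).comp measurable_snd)
    ((B.measurable_pol π hπ).comp measurable_fst)

lemma measurable_excess : Measurable (B.excess π) :=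
  (measurable_loss_apply hπ).sub (measurable_loss_apply B.opt_mem)

lemma measurableSet_ne_opt : MeasurableSet {x | π x ≠ B.opt x} :=
  (measurableSet_eq_fun (B.measurable_pol π hπ) (B.measurable_pol _ B.opt_mem)).compl

lemma measurable_disagree : Measurable (B.disagree π) :=
  Measurable.ite (measurable_fst (measurableSet_ne_opt hπ)) measurable_const measurable_const

lemma integrable_disagree : Integrable (B.disagree π) B.D :=
  Integrable.of_bound (measurable_disagree hπ).aestronglyMeasurable 1 (ae_of_all _ fun z => by
    rw [Real.norm_of_nonneg (B.disagree_nonneg π z)]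
    exact B.disagree_le_one π z)

lemma integral_disagree : ∫ z, B.disagree π z ∂B.D = B.rho π B.opt := by
  have hind : B.disagree π = (Prod.fst ⁻¹' {x | π x ≠ B.opt x}).indicator 1 := by
    ext z
    simp [disagree, Set.indicator_apply]
  rw [hind, integral_indicator_one (measurable_fst (measurableSet_ne_opt hπ)), rho, ctxLaw,
    map_measureReal_apply measurable_fst (measurableSet_ne_opt hπ)]

lemma integrable_loss_apply : Integrable (fun z => z.2 (π z.1)) B.D := by
  refine Integrable.of_bound (measurable_loss_apply hπ).aestronglyMeasurable 1 ?_
  filter_upwards [B.loss_mem] with z hz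
  rw [Real.norm_of_nonneg (hz _).1]
  exact (hz _).2

lemma integrable_excess : Integrable (B.excess π) B.D :=
  (integrable_loss_apply hπ).sub (integrable_loss_apply B.opt_mem)

lemma integral_excess : ∫ z, B.excess π z ∂B.D = B.risk π - B.risk B.opt :=
  integral_sub (integrable_loss_apply hπ) (integrable_loss_apply B.opt_mem)

lemma risk_sub_le_rho : B.risk π - B.risk B.opt ≤ B.rho π B.opt := by
  rw [← integral_excess hπ, ← integral_disagree hπ]
  refine integral_mono_ae (integrable_excess hπ) (integrable_disagree hπ) ?_
  filter_upwards [B.abs_excess_le_disagree π] with z hz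
  exact (le_abs_self _).trans hz

lemma integral_centered_excess_sq_le :
    ∫ z, (B.excess π z - (B.risk π - B.risk B.opt)) ^ 2 ∂B.D ≤ B.rho π B.opt := by
  have hmeas := measurable_excess hπ
  rw [← integral_excess hπ, ← variance_eq_integral hmeas.aemeasurable, ← integral_disagree hπ]
  refine (variance_le_expectation_sq hmeas.aestronglyMeasurable).trans ?_
  refine integral_mono_of_nonneg (ae_of_all _ fun z => sq_nonneg _) (integrable_disagree hπ) ?_
  filter_upwards [B.abs_excess_le_disagree π] with z hz
  calc B.excess π z ^ 2 = |B.excess π z| ^ 2 := (sq_abs _).symm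
    _ ≤ |B.excess π z| := pow_le_of_le_one (abs_nonneg _) (hz.trans (B.disagree_le_one π z))
        two_ne_zero
    _ ≤ B.disagree π z := hz

end Problem

section RunMeasurability

variable {X : Type*} [MeasurableSpace X] {K : ℕ} {Ω : Type*} [mΩ : MeasurableSpace Ω]
  {B : Problem X K} {ε δ : ℝ} {μ : Measure Ω} {𝓕 : Filtration ℕ mΩ} {S : Ω → Transcript X K}

/-- The context and the loss vector of round `n + 1`. -/
def sample (S : Ω → Transcript X K) (n : ℕ) (ω : Ω) : X × (Fin K → ℝ) :=
  ((S ω).ctx (n + 1), (S ω).loss (n + 1))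

/-- The information just before the action of round `n + 1` is drawn: the past together with the
context and the (unobserved) loss vector of that round. -/
abbrev preAct (𝓕 : Filtration ℕ mΩ) (S : Ω → Transcript X K) (n : ℕ) : MeasurableSpace Ω :=
  𝓕 n ⊔ MeasurableSpace.comap (sample S n) inferInstance

lemma le_preAct (𝓕 : Filtration ℕ mΩ) (S : Ω → Transcript X K) (n : ℕ) : 𝓕 n ≤ preAct 𝓕 S n :=
  le_sup_left

lemma measurable_sample_preAct (𝓕 : Filtration ℕ mΩ) (S : Ω → Transcript X K) (n : ℕ) :
    Measurable[preAct 𝓕 S n] (sample S n) :=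
  (comap_measurable (sample S n)).mono le_sup_right le_rfl

lemma measurable_ctx_preAct (𝓕 : Filtration ℕ mΩ) (S : Ω → Transcript X K) (n : ℕ) :
    Measurable[preAct 𝓕 S n] fun ω => (S ω).ctx (n + 1) :=
  measurable_fst.comp (measurable_sample_preAct 𝓕 S n)

lemma measurable_loss_preAct (𝓕 : Filtration ℕ mΩ) (S : Ω → Transcript X K) (n : ℕ) (a : Fin K) :
    Measurable[preAct 𝓕 S n] fun ω => (S ω).loss (n + 1) a :=
  (measurable_pi_apply a).comp (measurable_snd.comp (measurable_sample_preAct 𝓕 S n))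

lemma measurable_pol_ctx_preAct (𝓕 : Filtration ℕ mΩ) (S : Ω → Transcript X K) (n : ℕ)
    {π : X → Fin K} (hπ : π ∈ B.Pol) :
    Measurable[preAct 𝓕 S n] fun ω => π ((S ω).ctx (n + 1)) :=
  (B.measurable_pol π hπ).comp (measurable_ctx_preAct 𝓕 S n)

namespace IsRun

variable (h : IsRun B ε δ μ 𝓕 S) {π : X → Fin K}

include h

lemma measurable_sample_succ (n : ℕ) : Measurable[𝓕 (n + 1)] (sample S n) :=
  (h.ctx_meas n).prodMk (h.loss_meas n)

lemma measurable_sample (n : ℕ) : Measurable (sample S n) :=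
  (h.measurable_sample_succ n).mono (𝓕.le _) le_rfl

lemma preAct_le_succ (n : ℕ) : preAct 𝓕 S n ≤ 𝓕 (n + 1) :=
  sup_le (𝓕.mono n.le_succ) (h.measurable_sample_succ n).comap_le

lemma preAct_le (n : ℕ) : preAct 𝓕 S n ≤ mΩ := (h.preAct_le_succ n).trans (𝓕.le _)

lemma preAct_le_of_lt {s n : ℕ} (hs : s < n) : preAct 𝓕 S s ≤ 𝓕 n :=
  (h.preAct_le_succ s).trans (𝓕.mono hs)

lemma measurable_greedy (n : ℕ) :
    Measurable[preAct 𝓕 S n] fun ω => (S ω).pol (n + 1) ((S ω).ctx (n + 1)) := by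
  refine @measurable_to_countable' _ _ _ _ (preAct 𝓕 S n) _ fun a => ?_
  have hunion : (fun ω => (S ω).pol (n + 1) ((S ω).ctx (n + 1))) ⁻¹' {a}
      = ⋃ π ∈ B.Pol, {ω | (S ω).pol (n + 1) = π} ∩ (fun ω => π ((S ω).ctx (n + 1))) ⁻¹' {a} := by
    ext ω
    simp only [Set.mem_preimage, Set.mem_singleton_iff, Set.mem_iUnion, Set.mem_inter_iff,
      Set.mem_ofPred_eq, exists_prop]
    constructor
    · exact fun ha => ⟨_, (h.pol_oracle n ω).1, rfl, ha⟩
    · rintro ⟨π, -, rfl, ha⟩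
      exact ha
  rw [hunion]
  exact Finset.measurableSet_biUnion _ fun π hπ => (le_preAct 𝓕 S n _ (h.pol_meas n π hπ)).inter
    (measurable_pol_ctx_preAct 𝓕 S n hπ (measurableSet_singleton a))

-- The explored set of round `n + 1` depends on the sample of the first `n` rounds, which is built
-- from the earlier explored sets: the measurability of both is proved by a joint induction.
lemma measurableSet_mem_explored_of_empLoss {n : ℕ}
    (hloss : ∀ π ∈ B.Pol, Measurable[𝓕 n] fun ω => empLoss ((S ω).hatSample B.Pol ε δ n) π)
    (a : Fin K) : MeasurableSet[preAct 𝓕 S n] {ω | a ∈ (S ω).explored B.Pol ε δ (n + 1)} := by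
  have hunion : {ω | a ∈ (S ω).explored B.Pol ε δ (n + 1)}
      = ⋃ π ∈ B.Pol, (fun ω => π ((S ω).ctx (n + 1))) ⁻¹' {a} ∩ ⋂ π' ∈ B.Pol,
        {ω | empLoss ((S ω).hatSample B.Pol ε δ n) π - empLoss ((S ω).hatSample B.Pol ε δ n) π'
          ≤ threshold K B.Pol.card ε δ (n + 1)} := by
    ext ω
    simp only [Set.mem_ofPred_eq, mem_explored_succ_iff (h.pol_oracle n ω), Set.mem_iUnion,
      Set.mem_inter_iff, Set.mem_preimage, Set.mem_singleton_iff, Set.mem_iInter, exists_prop]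
  rw [hunion]
  exact Finset.measurableSet_biUnion _ fun π hπ =>
    (measurable_pol_ctx_preAct 𝓕 S n hπ (measurableSet_singleton a)).inter
      (Finset.measurableSet_biInter _ fun π' hπ' => le_preAct 𝓕 S n _
        (measurableSet_le ((hloss π hπ).sub (hloss π' hπ')) measurable_const))

section

variable {n : ℕ}
  (hA : ∀ a, MeasurableSet[preAct 𝓕 S n] {ω | a ∈ (S ω).explored B.Pol ε δ (n + 1)})
  (hπ : π ∈ B.Pol)

include hA hπ

omit h in
lemma measurable_tildeLoss_of_explored : Measurable[preAct 𝓕 S n]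
    fun ω => (S ω).tildeLoss B.Pol ε δ (n + 1) (π ((S ω).ctx (n + 1))) :=
  measurable_apply_of_countable (f := fun a ω => (S ω).tildeLoss B.Pol ε δ (n + 1) a)
    (fun a => Measurable.ite (hA a) (measurable_loss_preAct 𝓕 S n a) measurable_const)
    (measurable_pol_ctx_preAct 𝓕 S n hπ)

lemma measurable_ipsErr_of_explored (c : Fin K) : Measurable[preAct 𝓕 S n]
    fun ω => ipsErr ((S ω).prob B.Pol ε δ (n + 1)) ((S ω).exploredLoss B.Pol ε δ (n + 1)) c
      (π ((S ω).ctx (n + 1))) :=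
  measurable_apply_of_countable (f := fun a ω => ipsErr ((S ω).prob B.Pol ε δ (n + 1))
      ((S ω).exploredLoss B.Pol ε δ (n + 1)) c a)
    (measurable_ipsErr (measurable_playProb ε hA (h.measurable_greedy n))
      (fun a => Measurable.ite (hA a) (measurable_loss_preAct 𝓕 S n a) measurable_const) c)
    (measurable_pol_ctx_preAct 𝓕 S n hπ)

lemma measurable_hatLoss_of_explored : Measurable[𝓕 (n + 1)]
    fun ω => (S ω).hatLoss B.Pol ε δ (n + 1) (π ((S ω).ctx (n + 1))) := by
  have htilde := (measurable_tildeLoss_of_explored hA hπ).mono (h.preAct_le_succ n) le_rfl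
  have herr := measurable_apply_of_countable
    (fun c => (h.measurable_ipsErr_of_explored hA hπ c).mono (h.preAct_le_succ n) le_rfl)
    (h.act_meas n)
  convert herr.add htilde using 1
  ext ω
  simp [← Transcript.hatLoss_sub_tildeLoss]

end

lemma measurable_empLoss_hatSample (n : ℕ) (hπ : π ∈ B.Pol) :
    Measurable[𝓕 n] fun ω => empLoss ((S ω).hatSample B.Pol ε δ n) π := by
  induction n using Nat.strong_induction_on generalizing π with
  | _ n ih =>
    simp_rw [Transcript.empLoss_hatSample]
    refine (Finset.measurable_sum _ fun s hs => ?_).div_const _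
    rw [Finset.mem_range] at hs
    exact (h.measurable_hatLoss_of_explored
      (h.measurableSet_mem_explored_of_empLoss fun π hπ => ih s hs hπ) hπ).mono (𝓕.mono hs) le_rfl

lemma measurableSet_mem_explored (n : ℕ) (a : Fin K) :
    MeasurableSet[preAct 𝓕 S n] {ω | a ∈ (S ω).explored B.Pol ε δ (n + 1)} :=
  h.measurableSet_mem_explored_of_empLoss (fun _ hπ => h.measurable_empLoss_hatSample n hπ) a

lemma measurable_empLoss_tildeSample (n : ℕ) (hπ : π ∈ B.Pol) :
    Measurable[𝓕 n] fun ω => empLoss ((S ω).tildeSample B.Pol ε δ n) π := by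
  simp_rw [Transcript.empLoss_tildeSample]
  exact (Finset.measurable_sum _ fun s hs =>
    (measurable_tildeLoss_of_explored (h.measurableSet_mem_explored s) hπ).mono
      (h.preAct_le_of_lt (Finset.mem_range.1 hs)) le_rfl).div_const _

lemma measurable_empLoss_trueSample (n : ℕ) (hπ : π ∈ B.Pol) :
    Measurable[𝓕 n] fun ω => empLoss ((S ω).trueSample n) π := by
  simp_rw [Transcript.empLoss_trueSample]
  exact (Finset.measurable_sum _ fun s hs =>
    ((Problem.measurable_loss_apply hπ).comp (measurable_sample_preAct 𝓕 S s)).mono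
      (h.preAct_le_of_lt (Finset.mem_range.1 hs)) le_rfl).div_const _

lemma measurableSet_devBound (n : ℕ) : MeasurableSet[𝓕 n] {ω | DevBound B ε δ (S ω) n} := by
  simp_rw [DevBound, Set.ofPred_forall, Set.ofPred_and]
  refine Finset.measurableSet_biInter _ fun π hπ => MeasurableSet.inter ?_ ?_
  · exact measurableSet_le (continuous_abs.measurable.comp
      (((h.measurable_empLoss_hatSample n hπ).sub
        (h.measurable_empLoss_hatSample n B.opt_mem)).sub
          ((h.measurable_empLoss_tildeSample n hπ).sub
            (h.measurable_empLoss_tildeSample n B.opt_mem)))) measurable_const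
  · exact measurableSet_le (continuous_abs.measurable.comp
      (((h.measurable_empLoss_trueSample n hπ).sub
        (h.measurable_empLoss_trueSample n B.opt_mem)).sub measurable_const)) measurable_const

lemma measurableSet_devBoundUpTo (n : ℕ) :
    MeasurableSet[𝓕 n] {ω | DevBoundUpTo B ε δ (S ω) n} := by
  simp_rw [DevBoundUpTo, Set.ofPred_forall]
  exact MeasurableSet.iInter fun T => MeasurableSet.iInter fun _ => MeasurableSet.iInter fun hT =>
    𝓕.mono hT _ (h.measurableSet_devBound T)

lemma measurableSet_goodEvent : MeasurableSet (goodEvent B ε δ S) := by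
  simp_rw [goodEvent_eq, Set.ofPred_forall]
  exact MeasurableSet.iInter fun T => MeasurableSet.iInter fun _ =>
    𝓕.le T _ (h.measurableSet_devBound T)

end IsRun

end RunMeasurability

lemma condExp_apply_eq_sum {Ω ι : Type*} {m mΩ : MeasurableSpace Ω} {μ : Measure Ω}
    [IsFiniteMeasure μ] [Fintype ι] [DecidableEq ι] [MeasurableSpace ι]
    [MeasurableSingletonClass ι] {g : Ω → ι} {p f : ι → Ω → ℝ}
    (hg : Measurable g) (hp : ∀ i, μ[fun ω => if g ω = i then (1 : ℝ) else 0 | m] =ᵐ[μ] p i)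
    (hf : ∀ i, StronglyMeasurable[m] (f i)) (hfi : ∀ i, Integrable (f i) μ) :
    μ[fun ω => f (g ω) ω | m] =ᵐ[μ] fun ω => ∑ i, p i ω * f i ω := by
  set ind : ι → Ω → ℝ := fun i ω => if g ω = i then (1 : ℝ) else 0
  have hind_meas (i) : Measurable (ind i) :=
    Measurable.ite (hg (measurableSet_singleton i)) measurable_const measurable_const
  have hind_le (i ω) : ‖ind i ω‖ ≤ 1 := by
    simp only [ind]
    split_ifs <;> simp
  have hind_int (i) : Integrable (ind i) μ :=
    Integrable.of_bound (hind_meas i).aestronglyMeasurable 1 (ae_of_all _ (hind_le i))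
  have hmul_int (i) : Integrable (f i * ind i) μ :=
    (hfi i).mul_bdd (c := 1) (hind_meas i).aestronglyMeasurable (ae_of_all _ (hind_le i))
  have hsum : (fun ω => f (g ω) ω) = ∑ i, f i * ind i := by
    ext ω
    simp [ind]
  have hpull : ∀ᵐ ω ∂μ, ∀ i, (μ[f i * ind i | m]) ω = p i ω * f i ω := by
    refine ae_all_iff.2 fun i => ?_
    filter_upwards [condExp_mul_of_stronglyMeasurable_left (hf i) (hmul_int i) (hind_int i), hp i]
      with ω hω hpω
    rw [hω, Pi.mul_apply, hpω, mul_comm]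
  rw [hsum]
  filter_upwards [condExp_finsetSum (fun i _ => hmul_int i) m, hpull] with ω hω hpω
  rw [hω, Finset.sum_apply]
  exact Finset.sum_congr rfl fun i _ => hpω i

section MartingaleDifferences

variable {X : Type*} [MeasurableSpace X] {K : ℕ} {B : Problem X K} {ε δ : ℝ}

/-- The difference, between `π` and the optimal policy, of the errors of the inverse propensity
loss estimates in round `n + 1` if the action `c` is played. -/
def estErr (B : Problem X K) (ε δ : ℝ) (S : Transcript X K) (π : X → Fin K)
    (n : ℕ) (c : Fin K) : ℝ :=
  ipsErr (S.prob B.Pol ε δ (n + 1)) (S.exploredLoss B.Pol ε δ (n + 1)) c (π (S.ctx (n + 1)))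
    - ipsErr (S.prob B.Pol ε δ (n + 1)) (S.exploredLoss B.Pol ε δ (n + 1)) c
      (B.opt (S.ctx (n + 1)))

omit [MeasurableSpace X] in
lemma div_le_prob_of_exploredLoss_ne_zero (hε : 0 < ε) (hε1 : ε ≤ 1) (Pol : Finset (X → Fin K))
    (S : Transcript X K) (t : ℕ) (a : Fin K) (ha : S.exploredLoss Pol ε δ t a ≠ 0) :
    ε / K ≤ S.prob Pol ε δ t a :=
  div_le_playProb hε.le hε1 (by by_contra hA; exact ha (if_neg hA))

namespace IsExecution

variable {S : Transcript X K} (h : IsExecution B ε δ S)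

include h

lemma exploredLoss_mem_Icc (n : ℕ) (a : Fin K) :
    S.exploredLoss B.Pol ε δ (n + 1) a ∈ Set.Icc (0 : ℝ) 1 := by
  unfold Transcript.exploredLoss
  split_ifs
  · exact h.loss_mem n a
  · simp

variable (hε : 0 < ε) (hε1 : ε ≤ 1)

include hε hε1

lemma abs_estErr_le (π : X → Fin K) (n : ℕ) (c : Fin K) :
    |estErr B ε δ S π n c| ≤ K / ε + 1 := by
  have hK : (0 : ℝ) < K := by exact_mod_cast B.one_le_numActions
  rw [← inv_div]
  exact abs_ipsErr_sub_le (by positivity)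
    (div_le_prob_of_exploredLoss_ne_zero hε hε1 B.Pol S (n + 1)) (h.exploredLoss_mem_Icc n) _ _ _

variable (hδ : 0 < δ) (hδ1 : δ < 1)

include hδ hδ1

lemma sum_prob_mul_estErr (π : X → Fin K) (n : ℕ) :
    ∑ c, S.prob B.Pol ε δ (n + 1) c * estErr B ε δ S π n c = 0 := by
  have hK : (0 : ℝ) < K := by exact_mod_cast B.one_le_numActions
  exact sum_mul_ipsErr_sub (sum_playProb (pol_mem_explored hε hδ hδ1 (h.isOracle n)))
    (fun a ha => ((by positivity : 0 < ε / K).trans_le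
      (div_le_prob_of_exploredLoss_ne_zero hε hε1 B.Pol S (n + 1) a ha)).ne') _ _

lemma sum_prob_mul_estErr_sq_le (π : X → Fin K) (n : ℕ) :
    ∑ c, S.prob B.Pol ε δ (n + 1) c * estErr B ε δ S π n c ^ 2
      ≤ 2 * (K / ε) * B.disagree π (S.ctx (n + 1), S.loss (n + 1)) := by
  have hK : (0 : ℝ) < K := by exact_mod_cast B.one_le_numActions
  rw [← inv_div ε (K : ℝ)]
  exact sum_mul_ipsErr_sub_sq_le (sum_playProb (pol_mem_explored hε hδ hδ1 (h.isOracle n)))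
    (by positivity) (div_le_prob_of_exploredLoss_ne_zero hε hε1 B.Pol S (n + 1))
    (h.exploredLoss_mem_Icc n) _ _

end IsExecution

namespace IsRun

variable {Ω : Type*} [mΩ : MeasurableSpace Ω] {μ : Measure Ω} {𝓕 : Filtration ℕ mΩ}
  {S : Ω → Transcript X K} {π : X → Fin K} (h : IsRun B ε δ μ 𝓕 S)

include h

lemma map_sample (n : ℕ) : μ.map (sample S n) = B.D := h.law n

lemma ae_sample (n : ℕ) {p : X × (Fin K → ℝ) → Prop} (hp : ∀ᵐ z ∂B.D, p z) :
    ∀ᵐ ω ∂μ, p (sample S n ω) :=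
  ae_of_ae_map (h.measurable_sample n).aemeasurable (by rwa [h.map_sample n])

lemma ae_isExecution : ∀ᵐ ω ∂μ, IsExecution B ε δ (S ω) := by
  filter_upwards [ae_all_iff.2 fun n => h.ae_sample n B.loss_mem] with ω hω
  exact ⟨hω, fun t => h.pol_oracle t ω⟩

lemma integrable_comp_sample (n : ℕ) {g : X × (Fin K → ℝ) → ℝ} (hg : Integrable g B.D) :
    Integrable (fun ω => g (sample S n ω)) μ := by
  rw [← h.map_sample n] at hg
  exact hg.comp_measurable (h.measurable_sample n)

lemma measurable_estErr (hπ : π ∈ B.Pol) (n : ℕ) (c : Fin K) :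
    Measurable[preAct 𝓕 S n] fun ω => estErr B ε δ (S ω) π n c :=
  (h.measurable_ipsErr_of_explored (h.measurableSet_mem_explored n) hπ c).sub
    (h.measurable_ipsErr_of_explored (h.measurableSet_mem_explored n) B.opt_mem c)

variable [IsProbabilityMeasure μ]

lemma condExp_sample (n : ℕ) {g : X × (Fin K → ℝ) → ℝ} (hg : Measurable g) :
    μ[fun ω => g (sample S n ω) | 𝓕 n] =ᵐ[μ] fun _ => ∫ z, g z ∂B.D := by
  rw [← h.map_sample n,
    integral_map (h.measurable_sample n).aemeasurable hg.aestronglyMeasurable]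
  exact condExp_indep_eq (h.measurable_sample n).comap_le (𝓕.le n)
    (hg.comp (comap_measurable (sample S n))).stronglyMeasurable (h.indep n)

lemma condExp_act (n : ℕ) {f : Fin K → Ω → ℝ} {C : ℝ}
    (hf : ∀ c, Measurable[preAct 𝓕 S n] (f c)) (hC : ∀ c, ∀ᵐ ω ∂μ, |f c ω| ≤ C) :
    μ[fun ω => f ((S ω).act (n + 1)) ω | preAct 𝓕 S n] =ᵐ[μ]
      fun ω => ∑ c, (S ω).prob B.Pol ε δ (n + 1) c * f c ω :=
  condExp_apply_eq_sum ((h.act_meas n).mono (𝓕.le _) le_rfl) (h.act_law n)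
    (fun c => (hf c).stronglyMeasurable)
    fun c =>
      Integrable.of_bound ((hf c).mono (h.preAct_le n) le_rfl).aestronglyMeasurable C (hC c)

lemma isBoundedMartingaleDiff_excess (hπ : π ∈ B.Pol) :
    IsBoundedMartingaleDiff μ 𝓕
      (fun n ω => B.excess π (sample S n ω) - (B.risk π - B.risk B.opt)) 2 (B.rho π B.opt) where
  measurable_succ n :=
    ((Problem.measurable_excess hπ).comp (h.measurable_sample_succ n)).sub_const _
  ae_abs_le n := by
    filter_upwards [h.ae_sample n (B.abs_excess_le_disagree π)] with ω hω
    obtain ⟨hlow, hup⟩ := abs_le.1 (hω.trans (B.disagree_le_one π _))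
    have hrisk_nonneg := B.risk_opt_le hπ
    have hrisk_le := (Problem.risk_sub_le_rho hπ).trans (B.rho_le_one π B.opt)
    rw [abs_le]
    constructor <;> linarith
  condExp_eq_zero n := by
    filter_upwards [h.condExp_sample n ((Problem.measurable_excess hπ).sub_const _)] with ω hω
    rw [hω, integral_sub (Problem.integrable_excess hπ) (integrable_const _),
      Problem.integral_excess hπ, integral_const]
    simp
  condExp_sq_le n := by
    filter_upwards [h.condExp_sample n
      (((Problem.measurable_excess hπ).sub_const (B.risk π - B.risk B.opt)).pow_const 2)] with ω hω
    rw [hω]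
    exact Problem.integral_centered_excess_sq_le hπ

variable (hε : 0 < ε) (hε1 : ε ≤ 1) (hδ : 0 < δ) (hδ1 : δ < 1)

include hε hε1 hδ hδ1

lemma condExp_estErr_preAct (hπ : π ∈ B.Pol) (n : ℕ) :
    μ[fun ω => estErr B ε δ (S ω) π n ((S ω).act (n + 1)) | preAct 𝓕 S n] =ᵐ[μ] 0 := by
  have hact := h.condExp_act n (h.measurable_estErr hπ n)
    (fun c => h.ae_isExecution.mono fun ω hω => hω.abs_estErr_le hε hε1 π n c)
  filter_upwards [hact, h.ae_isExecution] with ω hω hexec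
  rw [hω]
  exact hexec.sum_prob_mul_estErr hε hε1 hδ hδ1 π n

lemma condExp_estErr_sq_preAct_le (hπ : π ∈ B.Pol) (n : ℕ) :
    μ[fun ω => estErr B ε δ (S ω) π n ((S ω).act (n + 1)) ^ 2 | preAct 𝓕 S n]
      ≤ᵐ[μ] fun ω => 2 * (K / ε) * B.disagree π (sample S n ω) := by
  have hact := h.condExp_act n (C := (K / ε + 1) ^ 2)
    (fun c => (h.measurable_estErr hπ n c).pow_const 2)
    (fun c => h.ae_isExecution.mono fun ω hω => by
      rw [abs_pow]
      exact pow_le_pow_left₀ (abs_nonneg _) (hω.abs_estErr_le hε hε1 π n c) 2)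
  filter_upwards [hact, h.ae_isExecution] with ω hω hexec
  rw [hω]
  exact hexec.sum_prob_mul_estErr_sq_le hε hε1 hδ hδ1 π n

lemma isBoundedMartingaleDiff_estErr (hπ : π ∈ B.Pol) :
    IsBoundedMartingaleDiff μ 𝓕 (fun n ω => estErr B ε δ (S ω) π n ((S ω).act (n + 1)))
      (K / ε + 1) (2 * (K / ε) * B.rho π B.opt) where
  measurable_succ n := measurable_apply_of_countable
    (fun c => (h.measurable_estErr hπ n c).mono (h.preAct_le_succ n) le_rfl) (h.act_meas n)
  ae_abs_le n := h.ae_isExecution.mono fun ω hω => hω.abs_estErr_le hε hε1 π n _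
  condExp_eq_zero n := by
    refine (condExp_condExp_of_le (le_preAct 𝓕 S n) (h.preAct_le n)).symm.trans ?_
    refine (condExp_congr_ae (h.condExp_estErr_preAct hε hε1 hδ hδ1 hπ n)).trans ?_
    rw [condExp_zero]
  condExp_sq_le n := by
    have htower := condExp_condExp_of_le (μ := μ)
      (f := fun ω => estErr B ε δ (S ω) π n ((S ω).act (n + 1)) ^ 2)
      (le_preAct 𝓕 S n) (h.preAct_le n)
    have hmono := condExp_mono (m := 𝓕 n) integrable_condExp
      (h.integrable_comp_sample n ((Problem.integrable_disagree hπ).const_mul (2 * (K / ε))))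
      (h.condExp_estErr_sq_preAct_le hε hε1 hδ hδ1 hπ n)
    filter_upwards [htower, hmono,
      h.condExp_sample n ((Problem.measurable_disagree hπ).const_mul (2 * (K / ε)))]
      with ω htowerω hmonoω hsampleω
    rw [← htowerω]
    refine hmonoω.trans (le_of_eq ?_)
    rw [hsampleω, integral_const_mul, Problem.integral_disagree hπ]

end IsRun

end MartingaleDifferences

lemma exp_neg_log_div_deltaT {N : ℕ} (hN : 1 ≤ N) {δ : ℝ} (hδ : 0 < δ) {T : ℕ} (hT : T ≠ 0) :
    Real.exp (-Real.log (2 * N / deltaT δ T)) = deltaT δ T / (2 * N) := by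
  have : (0 : ℝ) < N := by exact_mod_cast hN
  have : 0 < deltaT δ T := by unfold deltaT; positivity
  rw [Real.exp_neg, Real.exp_log (by positivity), inv_div]

lemma sum_deltaT_eq (δ : ℝ) {m : ℕ} (hm : m ≠ 0) (M : ℕ) :
    ∑ i ∈ Finset.range M, deltaT δ (m + i) = δ / m - δ / (m + M) := by
  induction M with
  | zero => simp
  | succ M ih =>
    have : (0 : ℝ) < m := by exact_mod_cast Nat.pos_of_ne_zero hm
    rw [Finset.sum_range_succ, ih]
    unfold deltaT
    push_cast
    field_simp
    ring

namespace IsBoundedMartingaleDiff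

variable {Ω : Type*} [mΩ : MeasurableSpace Ω] {μ : Measure Ω}
  {𝓕 : Filtration ℕ mΩ} {Y : ℕ → Ω → ℝ} {b v : ℝ}

lemma measureReal_not_abs_average_le [IsProbabilityMeasure μ]
    (h : IsBoundedMartingaleDiff μ 𝓕 Y b v) (hb : 0 < b) (hv : 0 ≤ v) {N : ℕ} (hN : 1 ≤ N)
    {δ : ℝ} (hδ : 0 < δ) (hδ1 : δ < 1) {T : ℕ} (hT : T ≠ 0) :
    μ.real {ω | ¬ |(∑ k ∈ Finset.range T, Y k ω) / T| ≤ √(v * eT N δ T) + b * eT N δ T}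
      ≤ deltaT δ T / N := by
  have hT0 : (0 : ℝ) < T := by exact_mod_cast Nat.pos_of_ne_zero hT
  have htail := h.measureReal_sqrt_add_le_abs_sum hb hv hT
    (zero_lt_one.trans_le (one_le_log_div_deltaT hN hδ hδ1 hT))
  have hbound : 2 * Real.exp (-Real.log (2 * N / deltaT δ T)) = deltaT δ T / N := by
    rw [exp_neg_log_div_deltaT hN hδ hT]
    ring
  rw [hbound] at htail
  refine (measureReal_mono fun ω hω => ?_).trans htail
  rw [Set.mem_ofPred_eq, not_le, abs_div, abs_of_pos hT0, lt_div_iff₀ hT0] at hω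
  refine le_of_eq_of_le ?_ hω.le
  unfold eT
  set l := Real.log (2 * N / deltaT δ T)
  rw [show 2 * T * v * l = v * (2 * l / T) * T ^ 2 by field_simp, Real.sqrt_mul' _ (sq_nonneg _),
    Real.sqrt_sq hT0.le]
  field_simp

lemma ae_abs_average_le_of_one_le (h : IsBoundedMartingaleDiff μ 𝓕 Y b v) (hb : 0 ≤ b) {T : ℕ}
    (hT : T ≠ 0) {e : ℝ} (he : 1 ≤ e) :
    ∀ᵐ ω ∂μ, |(∑ k ∈ Finset.range T, Y k ω) / T| ≤ √(v * e) + b * e := by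
  have hT0 : (0 : ℝ) < T := by exact_mod_cast Nat.pos_of_ne_zero hT
  filter_upwards [h.abs_sum_le T] with ω hω
  calc |(∑ k ∈ Finset.range T, Y k ω) / T| ≤ b := by
        rw [abs_div, abs_of_pos hT0, div_le_iff₀ hT0]
        linarith
    _ ≤ b * e := le_mul_of_one_le_right hb he
    _ ≤ √(v * e) + b * e := le_add_of_nonneg_left (Real.sqrt_nonneg _)

end IsBoundedMartingaleDiff

section DeviationProbability

variable {X : Type*} [MeasurableSpace X] {K : ℕ} {B : Problem X K} {ε δ : ℝ} {Ω : Type*}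

lemma average_estErr_eq (S : Transcript X K) (π : X → Fin K) (T : ℕ) :
    (∑ n ∈ Finset.range T, estErr B ε δ S π n (S.act (n + 1))) / T
      = (empLoss (S.hatSample B.Pol ε δ T) π - empLoss (S.hatSample B.Pol ε δ T) B.opt)
        - (empLoss (S.tildeSample B.Pol ε δ T) π
          - empLoss (S.tildeSample B.Pol ε δ T) B.opt) := by
  simp_rw [Transcript.empLoss_hatSample, Transcript.empLoss_tildeSample, ← sub_div,
    ← Finset.sum_sub_distrib]
  congr 1
  refine Finset.sum_congr rfl fun n _ => ?_
  rw [estErr, ← Transcript.hatLoss_sub_tildeLoss, ← Transcript.hatLoss_sub_tildeLoss]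
  ring

lemma average_centered_excess_eq (S : Ω → Transcript X K) (ω : Ω) (π : X → Fin K) {T : ℕ}
    (hT : T ≠ 0) :
    (∑ n ∈ Finset.range T, (B.excess π (sample S n ω) - (B.risk π - B.risk B.opt))) / T
      = (empLoss ((S ω).trueSample T) π - empLoss ((S ω).trueSample T) B.opt)
        - (B.risk π - B.risk B.opt) := by
  have hT0 : (T : ℝ) ≠ 0 := by exact_mod_cast hT
  simp_rw [Transcript.empLoss_trueSample, ← sub_div, ← Finset.sum_sub_distrib]
  rw [Finset.sum_sub_distrib, Finset.sum_const, Finset.card_range, nsmul_eq_mul, sub_div,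
    mul_div_cancel_left₀ _ hT0]
  rfl

lemma devBound_iff_average (S : Ω → Transcript X K) (ω : Ω) {T : ℕ} (hT : T ≠ 0) :
    DevBound B ε δ (S ω) T ↔ ∀ π ∈ B.Pol,
      |(∑ n ∈ Finset.range T, estErr B ε δ (S ω) π n ((S ω).act (n + 1))) / T|
        ≤ √(2 * (K / ε) * B.rho π B.opt * eT B.Pol.card δ T)
          + (K / ε + 1) * eT B.Pol.card δ T ∧
      |(∑ n ∈ Finset.range T, (B.excess π (sample S n ω) - (B.risk π - B.risk B.opt))) / T|
        ≤ √(B.rho π B.opt * eT B.Pol.card δ T) + 2 * eT B.Pol.card δ T := by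
  refine forall₂_congr fun π _ => ?_
  rw [average_estErr_eq, average_centered_excess_eq S ω π hT,
    show 2 * (K / ε) * B.rho π B.opt * eT B.Pol.card δ T
      = 2 * K * B.rho π B.opt * eT B.Pol.card δ T / ε by ring]

namespace IsRun

variable [mΩ : MeasurableSpace Ω] {μ : Measure Ω} [IsProbabilityMeasure μ]
  {𝓕 : Filtration ℕ mΩ} {S : Ω → Transcript X K} (h : IsRun B ε δ μ 𝓕 S)
  (hε : 0 < ε) (hε1 : ε ≤ 1) (hδ : 0 < δ) (hδ1 : δ < 1)

include h hε hε1 hδ hδ1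

lemma measureReal_not_devBound_le {T : ℕ} (hT : T ≠ 0) :
    μ.real {ω | ¬ DevBound B ε δ (S ω) T} ≤ 2 * deltaT δ T := by
  have hN : (0 : ℝ) < B.Pol.card := by exact_mod_cast B.one_le_card
  have hunion : {ω | ¬ DevBound B ε δ (S ω) T} = ⋃ π ∈ B.Pol,
      {ω | ¬ |(∑ n ∈ Finset.range T, estErr B ε δ (S ω) π n ((S ω).act (n + 1))) / T|
        ≤ √(2 * (K / ε) * B.rho π B.opt * eT B.Pol.card δ T)
          + (K / ε + 1) * eT B.Pol.card δ T} ∪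
      {ω | ¬ |(∑ n ∈ Finset.range T,
          (B.excess π (sample S n ω) - (B.risk π - B.risk B.opt))) / T|
        ≤ √(B.rho π B.opt * eT B.Pol.card δ T) + 2 * eT B.Pol.card δ T} := by
    ext ω
    simp only [devBound_iff_average S ω hT, Set.mem_ofPred_eq, Set.mem_iUnion, Set.mem_union,
      not_forall, not_and_or, exists_prop]
  calc μ.real {ω | ¬ DevBound B ε δ (S ω) T}
      ≤ ∑ _π ∈ B.Pol, (deltaT δ T / B.Pol.card + deltaT δ T / B.Pol.card) := by
        rw [hunion]
        refine (measureReal_biUnion_finset_le _ _).trans (Finset.sum_le_sum fun π hπ =>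
          (measureReal_union_le _ _).trans (add_le_add ?_ ?_))
        · exact (h.isBoundedMartingaleDiff_estErr hε hε1 hδ hδ1 hπ).measureReal_not_abs_average_le
            (by positivity) (mul_nonneg (by positivity) (B.rho_nonneg _ _)) B.one_le_card hδ hδ1 hT
        · exact (h.isBoundedMartingaleDiff_excess hπ).measureReal_not_abs_average_le
            two_pos (B.rho_nonneg _ _) B.one_le_card hδ hδ1 hT
    _ = 2 * deltaT δ T := by
        rw [Finset.sum_const, nsmul_eq_mul]
        field_simp
        ring

-- For `T ≤ 3` the widths exceed the trivial bounds on the deviations, since `1 ≤ e_T`.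
lemma ae_devBound_of_le_three {T : ℕ} (hT : T ≠ 0) (hT3 : T ≤ 3) :
    ∀ᵐ ω ∂μ, DevBound B ε δ (S ω) T := by
  have he := one_le_eT_of_le_three B.one_le_card hδ hδ1 hT hT3
  simp_rw [devBound_iff_average S _ hT]
  exact (ae_ball_iff B.Pol.countable_toSet).2 fun π hπ =>
    ((h.isBoundedMartingaleDiff_estErr hε hε1 hδ hδ1 hπ).ae_abs_average_le_of_one_le
      (by positivity) hT he).and
    ((h.isBoundedMartingaleDiff_excess hπ).ae_abs_average_le_of_one_le two_pos.le hT he)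

lemma measureReal_exists_not_devBound_le {m : ℕ} (hm : m ≠ 0) :
    μ.real {ω | ∃ T, m ≤ T ∧ ¬ DevBound B ε δ (S ω) T} ≤ 2 * (δ / m) := by
  have hunion : {ω | ∃ T, m ≤ T ∧ ¬ DevBound B ε δ (S ω) T}
      = ⋃ i, {ω | ¬ DevBound B ε δ (S ω) (m + i)} := by
    ext ω
    simp only [Set.mem_ofPred_eq, Set.mem_iUnion, le_iff_exists_add]
    exact ⟨fun ⟨_, ⟨i, hi⟩, hT⟩ => ⟨i, hi ▸ hT⟩, fun ⟨i, hi⟩ => ⟨_, ⟨i, rfl⟩, hi⟩⟩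
  have hpartial (M : ℕ) :
      ∑ i ∈ Finset.range M, μ.real {ω | ¬ DevBound B ε δ (S ω) (m + i)} ≤ 2 * (δ / m) :=
    calc ∑ i ∈ Finset.range M, μ.real {ω | ¬ DevBound B ε δ (S ω) (m + i)}
        ≤ ∑ i ∈ Finset.range M, 2 * deltaT δ (m + i) := Finset.sum_le_sum fun i _ =>
          h.measureReal_not_devBound_le hε hε1 hδ hδ1 (by omega)
      _ = 2 * (δ / m - δ / (m + M)) := by rw [← Finset.mul_sum, sum_deltaT_eq δ hm]
      _ ≤ 2 * (δ / m) := by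
          have : 0 ≤ δ / (m + M) := by positivity
          linarith
  refine ENNReal.toReal_le_of_le_ofReal (by positivity) ?_
  rw [hunion]
  refine (measure_iUnion_le _).trans (ENNReal.tsum_le_of_sum_range_le fun M => ?_)
  rw [← Finset.sum_congr rfl fun i _ => ofReal_measureReal,
    ← ENNReal.ofReal_sum_of_nonneg fun _ _ => measureReal_nonneg]
  exact ENNReal.ofReal_le_ofReal (hpartial M)

lemma measureReal_devBoundUpTo_diff_goodEvent_le (n : ℕ) :
    μ.real ({ω | DevBoundUpTo B ε δ (S ω) n} \ goodEvent B ε δ S) ≤ 2 * (δ / (n + 1 : ℕ)) := by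
  refine (measureReal_mono ?_).trans
    (h.measureReal_exists_not_devBound_le hε hε1 hδ hδ1 n.succ_ne_zero)
  rintro ω ⟨hupTo, hgood⟩
  rw [goodEvent_eq, Set.mem_ofPred_eq] at hgood
  push Not at hgood
  obtain ⟨T, hT, hfail⟩ := hgood
  exact ⟨T, not_lt.1 fun hlt => hfail (hupTo T hT (Nat.lt_succ_iff.1 hlt)), hfail⟩

lemma one_sub_half_le_measureReal_goodEvent : 1 - δ / 2 ≤ μ.real (goodEvent B ε δ S) := by
  have hupTo : ∀ᵐ ω ∂μ, ω ∈ {ω | DevBoundUpTo B ε δ (S ω) 3} := by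
    simp only [DevBoundUpTo, Set.mem_ofPred_eq, ae_all_iff]
    exact fun T hT hT3 =>
      h.ae_devBound_of_le_three hε hε1 hδ hδ1 (Nat.one_le_iff_ne_zero.1 hT) hT3
  have hdiff := h.measureReal_devBoundUpTo_diff_goodEvent_le hε hε1 hδ hδ1 3
  have hcompl : μ.real (goodEvent B ε δ S)ᶜ
      = μ.real ({ω | DevBoundUpTo B ε δ (S ω) 3} \ goodEvent B ε δ S) :=
    measureReal_congr (hupTo.mono fun ω hω => propext ⟨fun hbad => ⟨hω, hbad⟩, And.right⟩)
  rw [← hcompl, probReal_compl_eq_one_sub h.measurableSet_goodEvent] at hdiff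
  push_cast at hdiff
  linarith

end IsRun

end DeviationProbability

namespace Problem

variable {X : Type*} [MeasurableSpace X] {K : ℕ} (B : Problem X K)

lemma disRegion_eq_biUnion (r : ℝ) : B.disRegion r
    = ⋃ π ∈ B.Pol.filter fun π => B.rho π B.opt ≤ r, {x | π x ≠ B.opt x} := by
  ext x
  simp [disRegion, and_assoc]

lemma measurableSet_disRegion (r : ℝ) : MeasurableSet (B.disRegion r) := by
  rw [disRegion_eq_biUnion]
  exact Finset.measurableSet_biUnion _ fun π hπ =>
    measurableSet_ne_opt (Finset.mem_filter.1 hπ).1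

lemma measureReal_disRegion_le_sum (r : ℝ) : B.ctxLaw.real (B.disRegion r)
    ≤ ∑ π ∈ B.Pol.filter fun π => B.rho π B.opt ≤ r, B.rho π B.opt := by
  rw [disRegion_eq_biUnion]
  exact measureReal_biUnion_finset_le _ _

lemma measureReal_disRegion_le_card_mul {r : ℝ} (hr : 0 ≤ r) :
    B.ctxLaw.real (B.disRegion r) ≤ B.Pol.card * r :=
  calc B.ctxLaw.real (B.disRegion r)
      ≤ ∑ _π ∈ B.Pol.filter fun π => B.rho π B.opt ≤ r, r :=
        (B.measureReal_disRegion_le_sum r).trans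
          (Finset.sum_le_sum fun π hπ => (Finset.mem_filter.1 hπ).2)
    _ = (B.Pol.filter fun π => B.rho π B.opt ≤ r).card * r := by simp
    _ ≤ B.Pol.card * r := by
        gcongr
        exact Finset.filter_subset _ _

lemma measureReal_disRegion_le_disCoeff_mul {r : ℝ} (hr : 0 < r) :
    B.ctxLaw.real (B.disRegion r) ≤ B.disCoeff * r := by
  rw [← div_le_iff₀ hr]
  refine le_ciSup (f := fun s : Set.Ioi (0 : ℝ) => B.ctxLaw.real (B.disRegion s) / (s : ℝ))
    ⟨B.Pol.card, ?_⟩ ⟨r, hr⟩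
  rintro _ ⟨⟨s, hs⟩, rfl⟩
  exact (div_le_iff₀ hs).2 (B.measureReal_disRegion_le_card_mul (le_of_lt hs))

lemma disCoeff_nonneg : 0 ≤ B.disCoeff :=
  Real.iSup_nonneg fun r => div_nonneg measureReal_nonneg (le_of_lt r.2)

lemma one_le_disCoeff {π : X → Fin K} (hπ : π ∈ B.Pol) (hρ : 0 < B.rho π B.opt) :
    1 ≤ B.disCoeff := by
  have hsub : B.rho π B.opt ≤ B.ctxLaw.real (B.disRegion (B.rho π B.opt)) :=
    measureReal_mono fun x hx => ⟨π, hπ, le_rfl, hx⟩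
  exact le_of_mul_le_mul_right
    (by linarith [B.measureReal_disRegion_le_disCoeff_mul hρ]) hρ

lemma measureReal_disRegion_eq_zero (hρ : ∀ π ∈ B.Pol, B.rho π B.opt = 0) (r : ℝ) :
    B.ctxLaw.real (B.disRegion r) = 0 :=
  le_antisymm ((B.measureReal_disRegion_le_sum r).trans_eq
    (Finset.sum_eq_zero fun π hπ => hρ π (Finset.mem_filter.1 hπ).1)) measureReal_nonneg

lemma Massart.le_one {B : Problem X K} {τ : ℝ} (hτ : B.Massart τ) {π : X → Fin K}
    (hπ : π ∈ B.Pol) (hρ : 0 < B.rho π B.opt) : τ ≤ 1 := by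
  have hmassart : τ * B.rho π B.opt ≤ B.risk π - B.risk B.opt := by
    have := hτ.2 π hπ
    rwa [one_div, inv_mul_eq_div, le_div_iff₀' hτ.1] at this
  exact le_of_mul_le_mul_right (by linarith [risk_sub_le_rho hπ]) hρ

end Problem

section RoundRegret

variable {X : Type*} [MeasurableSpace X] {K : ℕ} {Ω : Type*} [mΩ : MeasurableSpace Ω]
  {B : Problem X K} {ε δ : ℝ} {μ : Measure Ω} {𝓕 : Filtration ℕ mΩ} {S : Ω → Transcript X K}

/-- The regret of round `n + 1`. -/
def roundRegret (B : Problem X K) (S : Transcript X K) (n : ℕ) : ℝ :=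
  S.loss (n + 1) (S.act (n + 1)) - S.loss (n + 1) (B.opt (S.ctx (n + 1)))

/-- The event that the action played in round `n + 1` is not that of the current policy. -/
def offPolicy (S : Ω → Transcript X K) (n : ℕ) : Set Ω :=
  {ω | (S ω).act (n + 1) ≠ (S ω).pol (n + 1) ((S ω).ctx (n + 1))}

lemma regret_eq_sum (B : Problem X K) (S : Transcript X K) (T : ℕ) :
    S.regret B.opt T = ∑ n ∈ Finset.range T, roundRegret B S n := by
  rw [Transcript.regret, Finset.range_eq_Ico, ← Finset.Ico_add_one_right_eq_Icc]
  exact (Finset.sum_Ico_add' (fun t => S.loss t (S.act t) - S.loss t (B.opt (S.ctx t))) 0 T 1).symm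

lemma sum_playProb_mul_ne_le {A : Finset (Fin K)} {b : Fin K} (hε : 0 ≤ ε) (hb : b ∈ A) :
    ∑ c, playProb ε A b c * (if c ≠ b then 1 else 0) ≤ if ∃ a ∈ A, a ≠ b then ε else 0 := by
  calc ∑ c, playProb ε A b c * (if c ≠ b then 1 else 0)
      = ∑ c ∈ Finset.univ.erase b, playProb ε A b c := by
        simp [← Finset.filter_ne', Finset.sum_filter]
    _ = 1 - playProb ε A b b := by
        rw [Finset.sum_erase_eq_sub (Finset.mem_univ b), sum_playProb hb]
    _ ≤ _ := one_sub_playProb_self_le hε hb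

lemma IsExecution.abs_loss_sub_le_one {S : Transcript X K} (h : IsExecution B ε δ S) (n : ℕ)
    (a a' : Fin K) : |S.loss (n + 1) a - S.loss (n + 1) a'| ≤ 1 := by
  simpa using abs_sub_le_of_le_of_le (h.loss_mem n a).1 (h.loss_mem n a).2
    (h.loss_mem n a').1 (h.loss_mem n a').2

namespace IsRun

variable (h : IsRun B ε δ μ 𝓕 S)

include h

lemma measurable_loss_act (n : ℕ) :
    Measurable[𝓕 (n + 1)] fun ω => (S ω).loss (n + 1) ((S ω).act (n + 1)) :=
  measurable_apply_of_countable (f := fun a ω => (S ω).loss (n + 1) a)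
    (fun a => (measurable_loss_preAct 𝓕 S n a).mono (h.preAct_le_succ n) le_rfl) (h.act_meas n)

lemma measurable_roundRegret (n : ℕ) : Measurable fun ω => roundRegret B (S ω) n :=
  ((h.measurable_loss_act n).mono (𝓕.le _) le_rfl).sub
    ((Problem.measurable_loss_apply B.opt_mem).comp (h.measurable_sample n))

lemma ae_abs_roundRegret_le (n : ℕ) : ∀ᵐ ω ∂μ, |roundRegret B (S ω) n| ≤ 1 :=
  h.ae_isExecution.mono fun _ hω => hω.abs_loss_sub_le_one n _ _

lemma measurable_excess_pol (n : ℕ) :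
    Measurable fun ω => B.excess ((S ω).pol (n + 1)) (sample S n ω) :=
  ((measurable_apply_of_countable (f := fun a ω => (S ω).loss (n + 1) a)
    (measurable_loss_preAct 𝓕 S n) (h.measurable_greedy n)).mono (h.preAct_le n) le_rfl).sub
    ((Problem.measurable_loss_apply B.opt_mem).comp (h.measurable_sample n))

lemma ae_abs_excess_pol_le (n : ℕ) :
    ∀ᵐ ω ∂μ, |B.excess ((S ω).pol (n + 1)) (sample S n ω)| ≤ 1 :=
  h.ae_isExecution.mono fun _ hω => hω.abs_loss_sub_le_one n _ _

lemma measurableSet_offPolicy (n : ℕ) : MeasurableSet (offPolicy S n) :=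
  (measurableSet_eq_fun ((h.act_meas n).mono (𝓕.le _) le_rfl)
    ((h.measurable_greedy n).mono (h.preAct_le n) le_rfl)).compl

lemma measureReal_ctx_mem (n : ℕ) {U : Set X} (hU : MeasurableSet U) :
    μ.real {ω | (S ω).ctx (n + 1) ∈ U} = B.ctxLaw.real U := by
  rw [Problem.ctxLaw, map_measureReal_apply measurable_fst hU, ← h.map_sample n,
    map_measureReal_apply (h.measurable_sample n) (measurable_fst hU)]
  rfl

variable [IsProbabilityMeasure μ]

lemma integrable_roundRegret (n : ℕ) : Integrable (fun ω => roundRegret B (S ω) n) μ :=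
  Integrable.of_bound (h.measurable_roundRegret n).aestronglyMeasurable 1
    (h.ae_abs_roundRegret_le n)

lemma integrable_excess_pol (n : ℕ) :
    Integrable (fun ω => B.excess ((S ω).pol (n + 1)) (sample S n ω)) μ :=
  Integrable.of_bound (h.measurable_excess_pol n).aestronglyMeasurable 1
    (h.ae_abs_excess_pol_le n)

lemma condExp_excess_pol (n : ℕ) :
    μ[fun ω => B.excess ((S ω).pol (n + 1)) (sample S n ω) | 𝓕 n] =ᵐ[μ]
      fun ω => B.risk ((S ω).pol (n + 1)) - B.risk B.opt := by
  classical
  set isPol : (X → Fin K) → Ω → ℝ := fun π ω => if (S ω).pol (n + 1) = π then 1 else 0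
  set exc : (X → Fin K) → Ω → ℝ := fun π ω => B.excess π (sample S n ω)
  have hdecomp : (fun ω => B.excess ((S ω).pol (n + 1)) (sample S n ω))
      = ∑ π ∈ B.Pol, isPol π * exc π := by
    ext ω
    simp [isPol, exc, (h.pol_oracle n ω).1]
  have hexc_int : ∀ π ∈ B.Pol, Integrable (exc π) μ := fun π hπ =>
    h.integrable_comp_sample n (Problem.integrable_excess hπ)
  have hisPol_meas : ∀ π ∈ B.Pol, Measurable[𝓕 n] (isPol π) := fun π hπ =>
    Measurable.ite (h.pol_meas n π hπ) measurable_const measurable_const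
  have hmul_int : ∀ π ∈ B.Pol, Integrable (isPol π * exc π) μ := fun π hπ =>
    (hexc_int π hπ).bdd_mul (c := 1)
      ((hisPol_meas π hπ).mono (𝓕.le n) le_rfl).aestronglyMeasurable
      (ae_of_all _ fun ω => by simp only [isPol]; split_ifs <;> simp)
  have hpull : ∀ᵐ ω ∂μ, ∀ π ∈ B.Pol,
      (μ[isPol π * exc π | 𝓕 n]) ω = isPol π ω * (B.risk π - B.risk B.opt) := by
    refine (ae_ball_iff (Finset.countable_toSet B.Pol)).2 fun π hπ => ?_
    filter_upwards [condExp_mul_of_stronglyMeasurable_left (hisPol_meas π hπ).stronglyMeasurable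
      (hmul_int π hπ) (hexc_int π hπ), h.condExp_sample n (Problem.measurable_excess hπ)]
      with ω hω hsample
    rw [hω, Pi.mul_apply, hsample, Problem.integral_excess hπ]
  rw [hdecomp]
  filter_upwards [condExp_finsetSum (μ := μ) hmul_int (𝓕 n), hpull] with ω hω hpullω
  rw [hω, Finset.sum_apply, Finset.sum_congr rfl hpullω]
  simp [isPol, (h.pol_oracle n ω).1]

lemma setIntegral_excess_pol_le {n : ℕ} {G : Set Ω} (hG : MeasurableSet[𝓕 n] G) {c : ℝ}
    (hc : 0 ≤ c) (hrisk : ∀ᵐ ω ∂μ, ω ∈ G → B.risk ((S ω).pol (n + 1)) - B.risk B.opt ≤ c) :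
    ∫ ω in G, B.excess ((S ω).pol (n + 1)) (sample S n ω) ∂μ ≤ c := by
  rw [← setIntegral_condExp (𝓕.le n) (h.integrable_excess_pol n) hG]
  calc _ ≤ ∫ _ in G, c ∂μ := by
        refine setIntegral_mono_on_ae integrable_condExp.integrableOn
          (integrable_const c).integrableOn (𝓕.le n _ hG) ?_
        filter_upwards [h.condExp_excess_pol n, hrisk] with ω hω hriskω hωG
        rw [hω]
        exact hriskω hωG
    _ = μ.real G * c := by simp
    _ ≤ c := mul_le_of_le_one_left hc measureReal_le_one

lemma condExp_offPolicy_le (hε : 0 < ε) (hδ : 0 < δ) (hδ1 : δ < 1) (n : ℕ) :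
    μ[(offPolicy S n).indicator 1 | preAct 𝓕 S n] ≤ᵐ[μ] fun ω =>
      if ∃ a ∈ (S ω).explored B.Pol ε δ (n + 1), a ≠ (S ω).pol (n + 1) ((S ω).ctx (n + 1))
      then ε else 0 := by
  set off : Fin K → Ω → ℝ := fun c ω => if c ≠ (S ω).pol (n + 1) ((S ω).ctx (n + 1)) then 1 else 0
  have hoff_meas (c) : Measurable[preAct 𝓕 S n] (off c) :=
    Measurable.ite (measurableSet_eq_fun measurable_const (h.measurable_greedy n)).compl
      measurable_const measurable_const
  have hoff_le (c) : ∀ᵐ ω ∂μ, |off c ω| ≤ 1 := ae_of_all _ fun ω => by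
    simp only [off]
    split_ifs <;> simp
  have hind : (offPolicy S n).indicator 1 = fun ω => off ((S ω).act (n + 1)) ω := by
    ext ω
    simp [offPolicy, off, Set.indicator_apply]
  rw [hind]
  filter_upwards [h.condExp_act n hoff_meas hoff_le] with ω hω
  rw [hω]
  exact sum_playProb_mul_ne_le hε.le (pol_mem_explored hε hδ hδ1 (h.pol_oracle n ω))

lemma measureReal_inter_offPolicy_le (hε : 0 < ε) (hδ : 0 < δ) (hδ1 : δ < 1) {n : ℕ} {G : Set Ω}
    (hG : MeasurableSet[𝓕 n] G) {U : Set X} (hU : MeasurableSet U)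
    (hGU : ∀ᵐ ω ∂μ, ω ∈ G → (∃ a ∈ (S ω).explored B.Pol ε δ (n + 1),
      a ≠ (S ω).pol (n + 1) ((S ω).ctx (n + 1))) → (S ω).ctx (n + 1) ∈ U) :
    μ.real (G ∩ offPolicy S n) ≤ ε * B.ctxLaw.real U := by
  have hctx : MeasurableSet {ω | (S ω).ctx (n + 1) ∈ U} :=
    h.measurable_sample n (measurable_fst hU)
  have hint : Integrable ({ω | (S ω).ctx (n + 1) ∈ U}.indicator fun _ => ε) μ :=
    (integrable_const ε).indicator hctx
  have hoff_int : Integrable ((offPolicy S n).indicator (1 : Ω → ℝ)) μ :=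
    (integrable_const 1).indicator (h.measurableSet_offPolicy n)
  calc μ.real (G ∩ offPolicy S n) = ∫ ω in G, (offPolicy S n).indicator 1 ω ∂μ := by
        rw [integral_indicator_one (h.measurableSet_offPolicy n),
          measureReal_restrict_apply (h.measurableSet_offPolicy n), Set.inter_comm]
    _ = ∫ ω in G, (μ[(offPolicy S n).indicator 1 | preAct 𝓕 S n]) ω ∂μ :=
        (setIntegral_condExp (h.preAct_le n) hoff_int (le_preAct 𝓕 S n _ hG)).symm
    _ ≤ ∫ ω in G, {ω | (S ω).ctx (n + 1) ∈ U}.indicator (fun _ => ε) ω ∂μ := by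
        refine setIntegral_mono_on_ae integrable_condExp.integrableOn hint.integrableOn
          (𝓕.le n _ hG) ?_
        filter_upwards [h.condExp_offPolicy_le hε hδ hδ1 n, hGU] with ω hω hGUω hωG
        refine hω.trans ?_
        split_ifs with hne
        · exact (Set.indicator_of_mem (s := {ω | (S ω).ctx (n + 1) ∈ U}) (hGUω hωG hne)
            fun _ => ε).ge
        · exact Set.indicator_nonneg (fun _ _ => hε.le) ω
    _ ≤ ∫ ω, {ω | (S ω).ctx (n + 1) ∈ U}.indicator (fun _ => ε) ω ∂μ :=
        setIntegral_le_integral hint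
          (ae_of_all _ fun ω => Set.indicator_nonneg (fun _ _ => hε.le) ω)
    _ = ε * B.ctxLaw.real U := by
        rw [integral_indicator_const _ hctx, smul_eq_mul, mul_comm, h.measureReal_ctx_mem n hU]

omit [IsProbabilityMeasure μ] in
lemma ae_roundRegret_le (n : ℕ) : ∀ᵐ ω ∂μ, roundRegret B (S ω) n
    ≤ (offPolicy S n).indicator 1 ω + B.excess ((S ω).pol (n + 1)) (sample S n ω) := by
  filter_upwards [h.ae_isExecution] with ω hω
  simp only [roundRegret, Problem.excess, sample]
  by_cases hoff : ω ∈ offPolicy S n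
  · rw [Set.indicator_of_mem hoff, Pi.one_apply]
    linarith [(abs_le.1 (hω.abs_loss_sub_le_one n ((S ω).act (n + 1))
      ((S ω).pol (n + 1) ((S ω).ctx (n + 1))))).2]
  · have hact : (S ω).act (n + 1) = (S ω).pol (n + 1) ((S ω).ctx (n + 1)) := not_not.1 hoff
    rw [Set.indicator_of_notMem hoff, hact, zero_add]

-- The event `G` will belong to the past, which allows conditioning, whereas `E` involves the
-- future: passing from `E` to `G` costs the last term.
lemma setIntegral_roundRegret_le {n : ℕ} {E G : Set Ω} (hEG : E ⊆ G) (hE : MeasurableSet E) :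
    ∫ ω in E, roundRegret B (S ω) n ∂μ ≤ μ.real (G ∩ offPolicy S n)
      + ∫ ω in G, B.excess ((S ω).pol (n + 1)) (sample S n ω) ∂μ + μ.real (G \ E) := by
  set exc : Ω → ℝ := fun ω => B.excess ((S ω).pol (n + 1)) (sample S n ω)
  have hexc_int : Integrable exc μ := h.integrable_excess_pol n
  have hoff := h.measurableSet_offPolicy n
  have hoff_int : Integrable ((offPolicy S n).indicator (1 : Ω → ℝ)) μ :=
    (integrable_const 1).indicator hoff
  have hsplit : ∫ ω in E, roundRegret B (S ω) n ∂μ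
      ≤ ∫ ω in E, (offPolicy S n).indicator 1 ω ∂μ + ∫ ω in E, exc ω ∂μ := by
    rw [← integral_add hoff_int.integrableOn hexc_int.integrableOn]
    exact integral_mono_ae (h.integrable_roundRegret n).integrableOn
      (hoff_int.add hexc_int).integrableOn (ae_restrict_of_ae (h.ae_roundRegret_le n))
  have hexplore : ∫ ω in E, (offPolicy S n).indicator (1 : Ω → ℝ) ω ∂μ
      ≤ μ.real (G ∩ offPolicy S n) := by
    rw [integral_indicator_one hoff, measureReal_restrict_apply hoff, Set.inter_comm]
    exact measureReal_mono (Set.inter_subset_inter_left _ hEG)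
  have hdiff : -∫ ω in G \ E, exc ω ∂μ ≤ μ.real (G \ E) := by
    rw [← integral_neg]
    refine (integral_mono_ae hexc_int.neg.integrableOn (integrable_const 1)
      (ae_restrict_of_ae ?_)).trans_eq (by simp)
    filter_upwards [h.ae_abs_excess_pol_le n] with ω hω
    exact (neg_le_abs _).trans hω
  linarith [setIntegral_sdiff (μ := μ) hE hexc_int.integrableOn hEG]

end IsRun

end RoundRegret

section Sums

lemma mul_rpow_sub_one_le_rpow_sub_rpow {p x : ℝ} (hp : 0 ≤ p) (hp1 : p ≤ 1) (hx : 1 ≤ x) :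
    p * x ^ (p - 1) ≤ x ^ p - (x - 1) ^ p := by
  have hx0 : 0 < x := by linarith
  have hbern : (1 + -x⁻¹) ^ p ≤ 1 + p * -x⁻¹ :=
    rpow_one_add_le_one_add_mul_self (by linarith [inv_le_one_of_one_le₀ hx]) hp hp1
  have hfactor : x - 1 = x * (1 + -x⁻¹) := by field_simp; ring
  have hbase : 0 ≤ 1 + -x⁻¹ := by linarith [inv_le_one_of_one_le₀ hx]
  rw [hfactor, Real.mul_rpow hx0.le hbase, Real.rpow_sub_one hx0.ne']
  linear_combination x ^ p * hbern

lemma sum_Icc_rpow_neg_le {s : ℝ} (hs : 0 ≤ s) (hs1 : s < 1) (T : ℕ) :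
    ∑ n ∈ Finset.Icc 1 T, (n : ℝ) ^ (-s) ≤ (T : ℝ) ^ (1 - s) / (1 - s) := by
  have hp : 0 < 1 - s := by linarith
  induction T with
  | zero => simp [Real.zero_rpow hp.ne']
  | succ T ih =>
    have hstep := mul_rpow_sub_one_le_rpow_sub_rpow hp.le (by linarith)
      (x := ((T + 1 : ℕ) : ℝ)) (by simp)
    have hexp : 1 - s - 1 = -s := by ring
    rw [hexp, mul_comm, Nat.cast_add_one, add_sub_cancel_right, ← le_div_iff₀ hp, sub_div] at hstep
    rw [Finset.sum_Icc_succ_top (by omega), Nat.cast_add_one]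
    linarith

lemma sum_Icc_inv_le_one_add_log (T : ℕ) :
    ∑ n ∈ Finset.Icc 1 T, (n : ℝ)⁻¹ ≤ 1 + Real.log T := by
  have hharm := harmonic_le_one_add_log T
  rw [harmonic_eq_sum_Icc] at hharm
  push_cast at hharm
  exact hharm

lemma min_one_le_rpow {x p : ℝ} (hx : 0 ≤ x) (hp : 0 ≤ p) (hp1 : p ≤ 1) : min 1 x ≤ x ^ p := by
  rcases le_total 1 x with h | h
  · rw [min_eq_left h]
    exact Real.one_le_rpow h hp
  · rw [min_eq_right h]
    exact Real.self_le_rpow_of_le_one hx h hp1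

lemma sum_Icc_min_one_div_le_mul_log {u : ℝ} (hu : 0 ≤ u) (T : ℕ) :
    ∑ n ∈ Finset.Icc 1 T, min 1 (u / n) ≤ u * (1 + Real.log T) :=
  calc ∑ n ∈ Finset.Icc 1 T, min 1 (u / n)
      ≤ ∑ n ∈ Finset.Icc 1 T, u * (n : ℝ)⁻¹ := Finset.sum_le_sum fun _ _ => min_le_right _ _
    _ = u * ∑ n ∈ Finset.Icc 1 T, (n : ℝ)⁻¹ := (Finset.mul_sum _ _ _).symm
    _ ≤ u * (1 + Real.log T) := mul_le_mul_of_nonneg_left (sum_Icc_inv_le_one_add_log T) hu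

lemma sum_Icc_min_one_div_le_rpow {u p : ℝ} (hu : 0 ≤ u) (hp : 0 ≤ p) (hp1 : p < 1) (T : ℕ) :
    ∑ n ∈ Finset.Icc 1 T, min 1 (u / n) ≤ u ^ p * ((T : ℝ) ^ (1 - p) / (1 - p)) :=
  calc ∑ n ∈ Finset.Icc 1 T, min 1 (u / n)
      ≤ ∑ n ∈ Finset.Icc 1 T, u ^ p * (n : ℝ) ^ (-p) := Finset.sum_le_sum fun n _ => by
        refine (min_one_le_rpow (by positivity) hp hp1.le).trans_eq ?_
        rw [Real.div_rpow hu n.cast_nonneg, Real.rpow_neg n.cast_nonneg, div_eq_mul_inv]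
    _ = u ^ p * ∑ n ∈ Finset.Icc 1 T, (n : ℝ) ^ (-p) := (Finset.mul_sum _ _ _).symm
    _ ≤ u ^ p * ((T : ℝ) ^ (1 - p) / (1 - p)) :=
        mul_le_mul_of_nonneg_left (sum_Icc_rpow_neg_le hp hp1 T) (by positivity)

end Sums

section Regret

variable {X : Type*} [MeasurableSpace X] {K : ℕ} {Ω : Type*} [mΩ : MeasurableSpace Ω]
  {B : Problem X K} {ε δ τ : ℝ} {μ : Measure Ω} [IsProbabilityMeasure μ]
  {𝓕 : Filtration ℕ mΩ} {S : Ω → Transcript X K}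

lemma log_div_nonneg {T N : ℕ} (hT : 1 ≤ T) (hN : 1 ≤ N) (hδ : 0 < δ) (hδ1 : δ < 1) :
    0 ≤ Real.log (T * N / δ) := by
  refine Real.log_nonneg ((one_le_div₀ hδ).2 (hδ1.le.trans ?_))
  exact_mod_cast Nat.mul_pos hT hN

namespace IsRun

variable (h : IsRun B ε δ μ 𝓕 S)

include h

lemma integral_regret_cond (T : ℕ) :
    ∫ ω, (S ω).regret B.opt T ∂μ[|goodEvent B ε δ S] = (μ.real (goodEvent B ε δ S))⁻¹ *
      ∑ n ∈ Finset.range T, ∫ ω in goodEvent B ε δ S, roundRegret B (S ω) n ∂μ := by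
  simp_rw [regret_eq_sum]
  rw [ProbabilityTheory.cond, integral_smul_measure, smul_eq_mul, ENNReal.toReal_inv,
    integral_finsetSum _ fun n _ => (h.integrable_roundRegret n).integrableOn, measureReal_def]

lemma setIntegral_roundRegret_le_one (n : ℕ) (E : Set Ω) :
    ∫ ω in E, roundRegret B (S ω) n ∂μ ≤ 1 :=
  calc ∫ ω in E, roundRegret B (S ω) n ∂μ ≤ ∫ _ in E, (1 : ℝ) ∂μ := by
        refine integral_mono_ae (h.integrable_roundRegret n).integrableOn (integrable_const 1)
          (ae_restrict_of_ae ?_)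
        filter_upwards [h.ae_abs_roundRegret_le n] with ω hω
        exact (le_abs_self _).trans hω
    _ = μ.real E := by simp
    _ ≤ 1 := measureReal_le_one

variable (hε : 0 < ε) (hδ : 0 < δ) (hδ1 : δ < 1)

include hε hδ hδ1

lemma ae_act_eq_pol_of_rho_eq_zero (hρ : ∀ π ∈ B.Pol, B.rho π B.opt = 0) (n : ℕ) :
    ∀ᵐ ω ∂μ, (S ω).act (n + 1) = (S ω).pol (n + 1) ((S ω).ctx (n + 1)) := by
  have hexplore : ∀ ω, (∃ a ∈ (S ω).explored B.Pol ε δ (n + 1),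
      a ≠ (S ω).pol (n + 1) ((S ω).ctx (n + 1))) → (S ω).ctx (n + 1) ∈ B.disRegion 1 := by
    rintro ω ⟨a, ha, hne⟩
    obtain ⟨π, hπ, hπa, -⟩ := (mem_explored_succ_iff (h.pol_oracle n ω)).1 ha
    by_cases hopt : a = B.opt ((S ω).ctx (n + 1))
    · exact ⟨_, (h.pol_oracle n ω).1, B.rho_le_one _ _, hopt ▸ hne.symm⟩
    · exact ⟨π, hπ, B.rho_le_one _ _, hπa ▸ hopt⟩
  have hoff : μ.real (offPolicy S n) ≤ 0 := by
    simpa [B.measureReal_disRegion_eq_zero hρ] using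
      h.measureReal_inter_offPolicy_le (n := n) hε hδ hδ1 MeasurableSet.univ
        (B.measurableSet_disRegion 1) (ae_of_all _ fun ω _ => hexplore ω)
  filter_upwards [measure_eq_zero_iff_ae_notMem.1
    ((measureReal_eq_zero_iff).1 (hoff.antisymm measureReal_nonneg))] with ω hω
  exact not_not.1 hω

lemma integral_regret_cond_of_rho_eq_zero (hρ : ∀ π ∈ B.Pol, B.rho π B.opt = 0) (T : ℕ) :
    ∫ ω, (S ω).regret B.opt T ∂μ[|goodEvent B ε δ S] = 0 := by
  rw [h.integral_regret_cond, Finset.sum_eq_zero, mul_zero]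
  intro n _
  have hctx : ∀ᵐ ω ∂μ, (S ω).ctx (n + 1) ∉ B.disRegion 1 := by
    refine measure_eq_zero_iff_ae_notMem.1 ((measureReal_eq_zero_iff).1 ?_)
    rw [← B.measureReal_disRegion_eq_zero hρ 1]
    exact h.measureReal_ctx_mem n (B.measurableSet_disRegion 1)
  refine integral_eq_zero_of_ae (ae_restrict_of_ae ?_)
  filter_upwards [hctx, h.ae_act_eq_pol_of_rho_eq_zero hε hδ hδ1 hρ n] with ω hω hact
  have hpol : (S ω).pol (n + 1) ((S ω).ctx (n + 1)) = B.opt ((S ω).ctx (n + 1)) := by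
    by_contra hne
    exact hω ⟨_, (h.pol_oracle n ω).1, B.rho_le_one _ _, hne⟩
  simp [roundRegret, hact, hpol]

variable (hε1 : ε ≤ 1)

include hε1

variable {n : ℕ} (hn : 1 ≤ n)

include hn

lemma measureReal_devBoundUpTo_diff_goodEvent_le_min :
    μ.real ({ω | DevBoundUpTo B ε δ (S ω) n} \ goodEvent B ε δ S)
      ≤ min 1 (K * eT B.Pol.card δ n / ε) := by
  refine le_min measureReal_le_one ?_
  have : (0 : ℝ) < n := by exact_mod_cast hn
  have hK : (1 : ℝ) ≤ K := by exact_mod_cast B.one_le_numActions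
  have he : 0 ≤ eT B.Pol.card δ n := eT_nonneg B.one_le_card hδ hδ1 n
  calc μ.real ({ω | DevBoundUpTo B ε δ (S ω) n} \ goodEvent B ε δ S)
      ≤ 2 * (δ / (n + 1 : ℕ)) := h.measureReal_devBoundUpTo_diff_goodEvent_le hε hε1 hδ hδ1 n
    _ ≤ 2 * (1 / n) := by gcongr; exact n.le_succ
    _ = 2 / n := by ring
    _ ≤ eT B.Pol.card δ n := two_div_le_eT B.one_le_card hδ hδ1 n
    _ ≤ K * eT B.Pol.card δ n / ε := by
        rw [le_div_iff₀ hε, mul_comm (K : ℝ)]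
        gcongr
        linarith

variable (hτ : B.Massart τ) (hτ1 : τ ≤ 1)

include hτ

lemma measureReal_devBoundUpTo_inter_offPolicy_le :
    μ.real ({ω | DevBoundUpTo B ε δ (S ω) n} ∩ offPolicy S n)
      ≤ min 1 (K * eT B.Pol.card δ n / ε)
        + 14 * (B.disCoeff / τ) * √(ε * K * eT B.Pol.card δ n) := by
  have hG := h.measurableSet_devBoundUpTo n
  have hτ0 : 0 < τ := hτ.1
  have hθ := B.disCoeff_nonneg
  have hn0 : (0 : ℝ) < n := by exact_mod_cast hn
  have hK : (0 : ℝ) < K := by exact_mod_cast B.one_le_numActions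
  have : 0 < eT B.Pol.card δ n :=
    (div_pos two_pos hn0).trans_le (two_div_le_eT B.one_le_card hδ hδ1 n)
  set e := eT B.Pol.card δ n
  set q : ℝ := K * e / ε with hq
  have : 0 < q := by positivity
  rcases le_total q 1 with hq1 | hq1
  · have hsqrt : ε * √q = √(ε * K * e) := by
      have hsq : ε * K * e = ε ^ 2 * q := by rw [hq]; field_simp
      rw [hsq, Real.sqrt_mul (by positivity), Real.sqrt_sq hε.le]
    calc μ.real ({ω | DevBoundUpTo B ε δ (S ω) n} ∩ offPolicy S n)
        ≤ ε * B.ctxLaw.real (B.disRegion (14 / τ * √q)) := by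
          refine h.measureReal_inter_offPolicy_le hε hδ hδ1 hG (B.measurableSet_disRegion _) ?_
          filter_upwards [h.ae_isExecution] with ω hω hωG
          exact hω.ctx_mem_disRegion hε hδ hδ1 hε1 hτ hn hωG hq1
      _ ≤ ε * (B.disCoeff * (14 / τ * √q)) := by
          gcongr
          exact B.measureReal_disRegion_le_disCoeff_mul (by positivity)
      _ = 14 * (B.disCoeff / τ) * √(ε * K * e) := by rw [← hsqrt]; ring
      _ ≤ min 1 q + 14 * (B.disCoeff / τ) * √(ε * K * e) :=
          le_add_of_nonneg_left (by positivity)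
  · rw [min_eq_left hq1]
    exact measureReal_le_one.trans (le_add_of_nonneg_right (by positivity))

include hτ1

lemma setIntegral_devBoundUpTo_excess_pol_le :
    ∫ ω in {ω | DevBoundUpTo B ε δ (S ω) n}, B.excess ((S ω).pol (n + 1)) (sample S n ω) ∂μ
      ≤ 17 / τ * min 1 (K * eT B.Pol.card δ n / ε) := by
  have hτ0 : 0 < τ := hτ.1
  have : 0 ≤ eT B.Pol.card δ n := eT_nonneg B.one_le_card hδ hδ1 n
  refine h.setIntegral_excess_pol_le (h.measurableSet_devBoundUpTo n) (by positivity) ?_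
  filter_upwards [h.ae_isExecution] with ω hω hdev
  have hrisk_le_one : B.risk ((S ω).pol (n + 1)) - B.risk B.opt ≤ 1 :=
    (Problem.risk_sub_le_rho (h.pol_oracle n ω).1).trans (B.rho_le_one _ _)
  rw [mul_min_of_nonneg _ _ (by positivity), mul_one]
  refine le_min (hrisk_le_one.trans ?_) (hω.risk_pol_sub_le hε hδ hδ1 hε1 hτ hn hdev hτ1)
  rw [le_div_iff₀ hτ0]
  linarith

lemma setIntegral_roundRegret_le_of_massart :
    ∫ ω in goodEvent B ε δ S, roundRegret B (S ω) n ∂μ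
      ≤ 19 / τ * min 1 (K * eT B.Pol.card δ n / ε)
        + 14 * (B.disCoeff / τ) * √(ε * K * eT B.Pol.card δ n) := by
  have hsplit := h.setIntegral_roundRegret_le (n := n) (goodEvent_subset_devBoundUpTo B ε δ S n)
    h.measurableSet_goodEvent
  have hexplore := h.measureReal_devBoundUpTo_inter_offPolicy_le hε hδ hδ1 hε1 hn hτ
  have hestimate := h.setIntegral_devBoundUpTo_excess_pol_le hε hδ hδ1 hε1 hn hτ hτ1
  have hfail := h.measureReal_devBoundUpTo_diff_goodEvent_le_min hε hδ hδ1 hε1 hn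
  set w := min 1 (K * eT B.Pol.card δ n / ε)
  have hw : w ≤ 1 / τ * w :=
    le_mul_of_one_le_left (measureReal_nonneg.trans hfail) (one_le_one_div hτ.1 hτ1)
  linear_combination hsplit + hexplore + hestimate + hfail + 2 * hw

lemma setIntegral_roundRegret_le_of_lt {T : ℕ} (hT : n < T) :
    ∫ ω in goodEvent B ε δ S, roundRegret B (S ω) n ∂μ
      ≤ 19 / τ * min 1 (6 * (K * Real.log (T * B.Pol.card / δ) / ε) / n)
        + 42 * (B.disCoeff / τ) * √(ε * K * Real.log (T * B.Pol.card / δ))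
          * (n : ℝ) ^ (-(1 / 2) : ℝ) := by
  have hτ0 : 0 < τ := hτ.1
  have hθ := B.disCoeff_nonneg
  have he := eT_le_of_lt B.one_le_card hδ hδ1 (Nat.one_le_iff_ne_zero.1 hn) hT
  have : 0 ≤ Real.log (T * B.Pol.card / δ) :=
    log_div_nonneg (hn.trans hT.le) B.one_le_card hδ hδ1
  set L := Real.log (T * B.Pol.card / δ)
  have hsqrt : √(ε * K * eT B.Pol.card δ n) ≤ 3 * (√(ε * K * L) * (n : ℝ) ^ (-(1 / 2) : ℝ)) :=
    calc √(ε * K * eT B.Pol.card δ n) ≤ √(ε * K * (6 * L / n)) := by gcongr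
      _ = √(6 * (ε * K * L / n)) := by ring_nf
      _ ≤ √(3 ^ 2 * (ε * K * L / n)) := by
          refine Real.sqrt_le_sqrt (mul_le_mul_of_nonneg_right (by norm_num) (by positivity))
      _ = 3 * (√(ε * K * L) * (n : ℝ) ^ (-(1 / 2) : ℝ)) := by
          rw [Real.sqrt_mul (by norm_num), Real.sqrt_sq (by norm_num),
            Real.sqrt_div' _ n.cast_nonneg, Real.rpow_neg n.cast_nonneg, ← Real.sqrt_eq_rpow,
            div_eq_mul_inv]
  refine (h.setIntegral_roundRegret_le_of_massart hε hδ hδ1 hε1 hn hτ hτ1).trans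
    (add_le_add ?_ ?_)
  · gcongr 19 / τ * min 1 ?_
    calc K * eT B.Pol.card δ n / ε ≤ K * (6 * L / n) / ε := by gcongr
      _ = 6 * (K * L / ε) / n := by ring
  · calc 14 * (B.disCoeff / τ) * √(ε * K * eT B.Pol.card δ n)
        ≤ 14 * (B.disCoeff / τ) * (3 * (√(ε * K * L) * (n : ℝ) ^ (-(1 / 2) : ℝ))) := by gcongr
      _ = 42 * (B.disCoeff / τ) * √(ε * K * L) * (n : ℝ) ^ (-(1 / 2) : ℝ) := by ring

omit hn

lemma sum_setIntegral_roundRegret_le {T : ℕ} (hT : 1 ≤ T) :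
    ∑ n ∈ Finset.range T, ∫ ω in goodEvent B ε δ S, roundRegret B (S ω) n ∂μ
      ≤ 1 + 19 / τ * ∑ n ∈ Finset.Icc 1 T,
          min 1 (6 * (K * Real.log (T * B.Pol.card / δ) / ε) / n)
        + 84 * (B.disCoeff / τ * √(ε * K * T * Real.log (T * B.Pol.card / δ))) := by
  have hτ0 : 0 < τ := hτ.1
  have hθ := B.disCoeff_nonneg
  have hL : 0 ≤ Real.log (T * B.Pol.card / δ) := log_div_nonneg hT B.one_le_card hδ hδ1
  set L := Real.log (T * B.Pol.card / δ)
  have hround : ∀ n ∈ Finset.Ico 1 T, ∫ ω in goodEvent B ε δ S, roundRegret B (S ω) n ∂μ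
      ≤ 19 / τ * min 1 (6 * (K * L / ε) / n)
        + 42 * (B.disCoeff / τ) * √(ε * K * L) * (n : ℝ) ^ (-(1 / 2) : ℝ) := fun n hn =>
    h.setIntegral_roundRegret_le_of_lt hε hδ hδ1 hε1 (Finset.mem_Ico.1 hn).1 hτ hτ1
      (Finset.mem_Ico.1 hn).2
  have hsqrt : ∑ n ∈ Finset.Icc 1 T, (n : ℝ) ^ (-(1 / 2) : ℝ) ≤ 2 * √T := by
    refine (sum_Icc_rpow_neg_le (by norm_num) (by norm_num) T).trans_eq ?_
    rw [Real.sqrt_eq_rpow]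
    norm_num
    ring
  rw [Finset.range_eq_Ico, Finset.sum_eq_sum_Ico_succ_bot hT, zero_add, add_assoc]
  refine add_le_add (h.setIntegral_roundRegret_le_one 0 _) ?_
  calc ∑ n ∈ Finset.Ico 1 T, ∫ ω in goodEvent B ε δ S, roundRegret B (S ω) n ∂μ
      ≤ ∑ n ∈ Finset.Icc 1 T, (19 / τ * min 1 (6 * (K * L / ε) / n)
          + 42 * (B.disCoeff / τ) * √(ε * K * L) * (n : ℝ) ^ (-(1 / 2) : ℝ)) :=
        (Finset.sum_le_sum hround).trans (Finset.sum_le_sum_of_subset_of_nonneg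
          Finset.Ico_subset_Icc_self fun n _ _ => by positivity)
    _ = 19 / τ * ∑ n ∈ Finset.Icc 1 T, min 1 (6 * (K * L / ε) / n)
        + 42 * (B.disCoeff / τ) * √(ε * K * L)
          * ∑ n ∈ Finset.Icc 1 T, (n : ℝ) ^ (-(1 / 2) : ℝ) := by
        rw [Finset.sum_add_distrib, Finset.mul_sum, Finset.mul_sum]
    _ ≤ 19 / τ * ∑ n ∈ Finset.Icc 1 T, min 1 (6 * (K * L / ε) / n)
        + 42 * (B.disCoeff / τ) * √(ε * K * L) * (2 * √T) := by gcongr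
    _ = 19 / τ * ∑ n ∈ Finset.Icc 1 T, min 1 (6 * (K * L / ε) / n)
        + 84 * (B.disCoeff / τ * √(ε * K * T * L)) := by
        rw [mul_right_comm (ε * K), Real.sqrt_mul (by positivity) (T : ℝ)]
        ring

lemma integral_regret_cond_le {T : ℕ} (hT : 1 ≤ T) :
    ∫ ω, (S ω).regret B.opt T ∂μ[|goodEvent B ε δ S]
      ≤ 2 * (1 + 19 / τ * ∑ n ∈ Finset.Icc 1 T,
          min 1 (6 * (K * Real.log (T * B.Pol.card / δ) / ε) / n)
        + 84 * (B.disCoeff / τ * √(ε * K * T * Real.log (T * B.Pol.card / δ)))) := by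
  have hτ0 : 0 < τ := hτ.1
  have hθ := B.disCoeff_nonneg
  have hL : 0 ≤ Real.log (T * B.Pol.card / δ) := log_div_nonneg hT B.one_le_card hδ hδ1
  have hhalf : 2⁻¹ ≤ μ.real (goodEvent B ε δ S) := by
    linarith [h.one_sub_half_le_measureReal_goodEvent hε hε1 hδ hδ1]
  rw [h.integral_regret_cond]
  refine (mul_le_mul_of_nonneg_left (h.sum_setIntegral_roundRegret_le hε hδ hδ1 hε1 hτ hτ1 hT)
    (by positivity)).trans (mul_le_mul_of_nonneg_right (inv_le_of_inv_le₀ two_pos hhalf) ?_)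
  positivity

end IsRun

end Regret

section Tuning

/-- The exploration parameter which equalizes the two terms `a * l / ε` and `θ * √(ε * a * t)` of
the regret bound, where `a = K * log (T * |Π| / δ)`, `t = T` and `l = log T`. -/
def balancedParam (a θ t l : ℝ) : ℝ := (a * l ^ 2 / (θ ^ 2 * t)) ^ (1 / 3 : ℝ)

/-- The exploration parameter of the algorithm: the balanced one, truncated to `(0, 1]`. The
degenerate case serves problems with `θ = 0`, where there is nothing to explore. -/
def tunedParam (a θ t l : ℝ) : ℝ :=
  if 0 < balancedParam a θ t l then min 1 (balancedParam a θ t l) else 1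

/-- The common value of the two terms `a * l / ε` and `θ * √(ε * a * t)` of the regret bound when
the exploration parameter is balanced. -/
def balancedRate (a θ t l : ℝ) : ℝ := (θ * a) ^ (2 / 3 : ℝ) * (t * l) ^ (1 / 3 : ℝ)

variable {a θ t l : ℝ}

lemma tunedParam_pos : 0 < tunedParam a θ t l := by
  unfold tunedParam
  split_ifs with h
  · exact lt_min one_pos h
  · exact one_pos

lemma tunedParam_le_one : tunedParam a θ t l ≤ 1 := by
  unfold tunedParam
  split_ifs
  · exact min_le_left _ _
  · exact le_rfl

lemma rpow_one_third_pow_three {x : ℝ} (hx : 0 ≤ x) : (x ^ (1 / 3 : ℝ)) ^ 3 = x := by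
  rw [← Real.rpow_mul_natCast hx]
  norm_num

lemma rpow_two_thirds_pow_three {x : ℝ} (hx : 0 ≤ x) : (x ^ (2 / 3 : ℝ)) ^ 3 = x ^ 2 := by
  rw [← Real.rpow_mul_natCast hx]
  norm_num

variable (ha : 0 < a) (hθ : 0 < θ) (ht : 0 < t) (hl : 0 < l)

include ha hθ ht hl

lemma balancedRate_pos : 0 < balancedRate a θ t l := by
  unfold balancedRate
  positivity

lemma balancedRate_pow_three : balancedRate a θ t l ^ 3 = (θ * a) ^ 2 * (t * l) := by
  rw [balancedRate, mul_pow, rpow_two_thirds_pow_three (by positivity),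
    rpow_one_third_pow_three (by positivity)]

lemma balancedParam_pos : 0 < balancedParam a θ t l := by
  unfold balancedParam
  positivity

lemma balancedParam_pow_three : balancedParam a θ t l ^ 3 = a * l ^ 2 / (θ ^ 2 * t) :=
  rpow_one_third_pow_three (by positivity)

lemma tunedParam_eq_min : tunedParam a θ t l = min 1 (balancedParam a θ t l) :=
  if_pos (balancedParam_pos ha hθ ht hl)

lemma div_balancedParam_mul_eq : a / balancedParam a θ t l * l = balancedRate a θ t l := by
  have hpos := balancedParam_pos ha hθ ht hl
  rw [← pow_left_inj₀ (by positivity) (balancedRate_pos ha hθ ht hl).le three_ne_zero,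
    balancedRate_pow_three ha hθ ht hl, mul_pow, div_pow, balancedParam_pow_three ha hθ ht hl]
  field_simp

lemma mul_sqrt_tunedParam_le : θ * √(tunedParam a θ t l * a * t) ≤ balancedRate a θ t l := by
  have hε := tunedParam_pos (a := a) (θ := θ) (t := t) (l := l)
  have hcube : tunedParam a θ t l ^ 3 ≤ a * l ^ 2 / (θ ^ 2 * t) := by
    rw [← balancedParam_pow_three ha hθ ht hl, tunedParam_eq_min ha hθ ht hl]
    gcongr
    · exact (lt_min one_pos (balancedParam_pos ha hθ ht hl)).le
    · exact min_le_right _ _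
  have hrate := balancedRate_pos ha hθ ht hl
  refine (sq_le_sq₀ (by positivity) hrate.le).1 ?_
  rw [mul_pow, Real.sq_sqrt (by positivity)]
  refine (pow_le_pow_iff_left₀ (by positivity) (by positivity) three_ne_zero).1 ?_
  calc (θ ^ 2 * (tunedParam a θ t l * a * t)) ^ 3
      = θ ^ 6 * (tunedParam a θ t l ^ 3 * (a * t) ^ 3) := by ring
    _ ≤ θ ^ 6 * (a * l ^ 2 / (θ ^ 2 * t) * (a * t) ^ 3) := by gcongr
    _ = ((θ * a) ^ 2 * (t * l)) ^ 2 := by field_simp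
    _ = (balancedRate a θ t l ^ 2) ^ 3 := by rw [← balancedRate_pow_three ha hθ ht hl]; ring

omit hθ

lemma rpow_two_thirds_mul_rpow_one_third_le (hθ1 : 1 ≤ θ) (hl2 : Real.log 2 ≤ l) :
    (6 * a) ^ (2 / 3 : ℝ) * t ^ (1 / 3 : ℝ) ≤ 4 * balancedRate a θ t l := by
  have hθ : 0 < θ := by linarith
  have hrate := balancedRate_pos ha hθ ht hl
  refine (pow_le_pow_iff_left₀ (by positivity) (by positivity) three_ne_zero).1 ?_
  rw [mul_pow, mul_pow, rpow_two_thirds_pow_three (by positivity), rpow_one_third_pow_three ht.le,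
    balancedRate_pow_three ha hθ ht hl]
  calc (6 * a) ^ 2 * t = 36 * (1 * a) ^ 2 * t := by ring
    _ ≤ 4 ^ 3 * l * (θ * a) ^ 2 * t := by
        gcongr
        linarith [Real.log_two_gt_d9]
    _ = 4 ^ 3 * ((θ * a) ^ 2 * (t * l)) := by ring

omit ha ht hl

lemma one_le_two_mul_balancedRate (ha2 : Real.log 2 ≤ a) (hθ1 : 1 ≤ θ) (ht2 : 2 ≤ t)
    (hl2 : Real.log 2 ≤ l) : 1 ≤ 2 * balancedRate a θ t l := by
  have hlog := Real.log_two_gt_d9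
  have hrate := balancedRate_pos (by linarith : 0 < a) (by linarith : 0 < θ) (by linarith : 0 < t)
    (by linarith : 0 < l)
  refine (pow_le_pow_iff_left₀ zero_le_one (by positivity) three_ne_zero).1 ?_
  rw [mul_pow, balancedRate_pow_three (by linarith) (by linarith) (by linarith) (by linarith)]
  calc (1 : ℝ) ^ 3 ≤ 2 ^ 3 * ((1 * 0.69) ^ 2 * (2 * 0.69)) := by norm_num
    _ ≤ 2 ^ 3 * ((θ * a) ^ 2 * (t * l)) := by
        gcongr <;> linarith

lemma one_add_log_le {T : ℕ} (hT : 2 ≤ T) : 1 + Real.log T ≤ 3 * Real.log T := by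
  have hl : Real.log 2 ≤ Real.log T := Real.log_le_log two_pos (by exact_mod_cast hT)
  linarith [Real.log_two_gt_d9]

lemma sum_Icc_min_one_div_le_eighteen_mul_log {u : ℝ} (hu : 0 ≤ u) {T : ℕ} (hT : 2 ≤ T) :
    ∑ n ∈ Finset.Icc 1 T, min 1 (6 * u / n) ≤ 18 * (u * Real.log T) :=
  calc ∑ n ∈ Finset.Icc 1 T, min 1 (6 * u / n)
      ≤ 6 * u * (1 + Real.log T) := sum_Icc_min_one_div_le_mul_log (by positivity) T
    _ ≤ 6 * u * (3 * Real.log T) := by gcongr; exact one_add_log_le hT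
    _ = 18 * (u * Real.log T) := by ring

lemma sum_Icc_min_one_div_tunedParam_le (ha : 0 < a) (hθ1 : 1 ≤ θ) {T : ℕ} (hT : 2 ≤ T) :
    ∑ n ∈ Finset.Icc 1 T, min 1 (6 * (a / tunedParam a θ T (Real.log T)) / n)
      ≤ 18 * balancedRate a θ T (Real.log T) := by
  have hθ : 0 < θ := by linarith
  have ht : (0 : ℝ) < T := by positivity
  have hl2 : Real.log 2 ≤ Real.log T := Real.log_le_log two_pos (by exact_mod_cast hT)
  have hl : 0 < Real.log T := (Real.log_pos one_lt_two).trans_le hl2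
  have hpos := balancedParam_pos ha hθ ht hl
  rw [tunedParam_eq_min ha hθ ht hl]
  rcases le_total (balancedParam a θ T (Real.log T)) 1 with hle | hge
  · rw [min_eq_right hle, ← div_balancedParam_mul_eq ha hθ ht hl]
    exact sum_Icc_min_one_div_le_eighteen_mul_log (by positivity) hT
  · -- Here `a * log T` may exceed the balanced rate, so the harmonic sum is too coarse; summing
    -- `min 1 x ≤ x ^ (2 / 3)` instead avoids the factor `log T`.
    rw [min_eq_left hge, div_one]
    calc ∑ n ∈ Finset.Icc 1 T, min 1 (6 * a / n)
        ≤ (6 * a) ^ (2 / 3 : ℝ) * ((T : ℝ) ^ (1 - 2 / 3 : ℝ) / (1 - 2 / 3)) :=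
          sum_Icc_min_one_div_le_rpow (by positivity) (by norm_num) (by norm_num) T
      _ = 3 * ((6 * a) ^ (2 / 3 : ℝ) * (T : ℝ) ^ (1 / 3 : ℝ)) := by norm_num; ring
      _ ≤ 3 * (4 * balancedRate a θ T (Real.log T)) := by
          gcongr 3 * ?_
          exact rpow_two_thirds_mul_rpow_one_third_le ha ht hl hθ1 hl2
      _ ≤ 18 * balancedRate a θ T (Real.log T) := by
          linarith [balancedRate_pos ha hθ ht hl]

end Tuning

section Conclusion

variable {X : Type*} [MeasurableSpace X] {K : ℕ} {Ω : Type*} [mΩ : MeasurableSpace Ω]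
  {B : Problem X K} {ε δ τ : ℝ} {μ : Measure Ω} [IsProbabilityMeasure μ]
  {𝓕 : Filtration ℕ mΩ} {S : Ω → Transcript X K}

lemma log_two_le_mul_log_div {T N : ℕ} (hK : 1 ≤ K) (hT : 2 ≤ T) (hN : 1 ≤ N) (hδ : 0 < δ)
    (hδ1 : δ < 1) : Real.log 2 ≤ K * Real.log (T * N / δ) := by
  have hTN : (2 : ℝ) ≤ T * N := by exact_mod_cast Nat.mul_le_mul hT hN
  have hlog : Real.log 2 ≤ Real.log (T * N / δ) :=
    Real.log_le_log two_pos ((le_div_iff₀ hδ).2 (by linarith))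
  exact hlog.trans (le_mul_of_one_le_left ((Real.log_nonneg one_le_two).trans hlog)
    (by exact_mod_cast hK))

namespace IsRun

variable (hδ : 0 < δ) (hδ1 : δ < 1) (hτ : B.Massart τ)

include hδ hδ1 hτ

-- Either all policies agree almost surely, and there is no regret, or `1 ≤ θ` and `τ ≤ 1`.
lemma integral_regret_cond_le_of_sum_le {T : ℕ} (hT : 1 ≤ T) (h : IsRun B ε δ μ 𝓕 S) (hε : 0 < ε)
    (hε1 : ε ≤ 1) {A : ℝ} (hA : 0 ≤ A) (hA1 : 1 ≤ B.disCoeff → 1 ≤ 3 * A)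
    (hsum : 1 ≤ B.disCoeff → ∑ n ∈ Finset.Icc 1 T,
      min 1 (6 * (K * Real.log (T * B.Pol.card / δ) / ε) / n) ≤ 18 * A) :
    ∫ ω, (S ω).regret B.opt T ∂μ[|goodEvent B ε δ S]
      ≤ 1 / τ * (690 * A
        + 168 * (B.disCoeff * √(ε * K * T * Real.log (T * B.Pol.card / δ)))) := by
  have hτ0 := hτ.1
  have hθ := B.disCoeff_nonneg
  by_cases hρ : ∀ π ∈ B.Pol, B.rho π B.opt = 0
  · rw [h.integral_regret_cond_of_rho_eq_zero hε hδ hδ1 hρ]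
    positivity
  push Not at hρ
  obtain ⟨π, hπ, hρ⟩ := hρ
  have hρ0 : 0 < B.rho π B.opt := (B.rho_nonneg _ _).lt_of_ne' hρ
  have hτ1 : τ ≤ 1 := hτ.le_one hπ hρ0
  have hθ1 : 1 ≤ B.disCoeff := B.one_le_disCoeff hπ hρ0
  have hfirst : 1 ≤ 1 / τ * (3 * A) :=
    one_le_mul_of_one_le_of_one_le (one_le_one_div hτ0 hτ1) (hA1 hθ1)
  have hrest := mul_le_mul_of_nonneg_left (hsum hθ1) (by positivity : 0 ≤ 19 / τ)
  linear_combination h.integral_regret_cond_le hε hδ hδ1 hε1 hτ hτ1 hT + 2 * hfirst + 2 * hrest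

variable {T : ℕ} (hT : 2 ≤ T)

include hT

theorem integral_regret_cond_le_of_massart (h : IsRun B ε δ μ 𝓕 S) (hε : 0 < ε) (hε1 : ε ≤ 1) :
    ∫ ω, (S ω).regret B.opt T ∂μ[|goodEvent B ε δ S]
      ≤ 690 * (K * Real.log (T * B.Pol.card / δ) / (τ * ε) * Real.log T
        + B.disCoeff / τ * √(ε * K * T * Real.log (T * B.Pol.card / δ))) := by
  have hτ0 := hτ.1
  have hθ := B.disCoeff_nonneg
  have hlog2 := Real.log_two_gt_d9
  have ha := log_two_le_mul_log_div B.one_le_numActions hT B.one_le_card hδ hδ1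
  have hl : Real.log 2 ≤ Real.log T := Real.log_le_log two_pos (by exact_mod_cast hT)
  set L := Real.log (T * B.Pol.card / δ)
  set l := Real.log T
  have hu : Real.log 2 ≤ K * L / ε := ha.trans (le_div_self (by linarith) hε hε1)
  have hA : 0.69 * 0.69 ≤ K * L / ε * l := by gcongr <;> linarith
  refine (h.integral_regret_cond_le_of_sum_le hδ hδ1 hτ (one_le_two.trans hT) hε hε1
    (A := K * L / ε * l) (by linarith) (fun _ => by linarith) fun _ =>
    sum_Icc_min_one_div_le_eighteen_mul_log (by linarith) hT).trans ?_
  have hB : 0 ≤ B.disCoeff / τ * √(ε * K * T * L) := by positivity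
  have hsplit : K * L / ε * l / τ = K * L / (τ * ε) * l := by field_simp
  linear_combination 522 * hB + 690 * hsplit

theorem integral_regret_cond_le_of_tunedParam
    (hε : ε = tunedParam (K * Real.log (T * B.Pol.card / δ)) B.disCoeff T (Real.log T))
    (h : IsRun B ε δ μ 𝓕 S) :
    ∫ ω, (S ω).regret B.opt T ∂μ[|goodEvent B ε δ S]
      ≤ 858 * (1 / τ * balancedRate (K * Real.log (T * B.Pol.card / δ)) B.disCoeff T
        (Real.log T)) := by
  have hθ := B.disCoeff_nonneg
  have hτ0 := hτ.1
  have ha2 := log_two_le_mul_log_div B.one_le_numActions hT B.one_le_card hδ hδ1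
  have hl2 : Real.log 2 ≤ Real.log T := Real.log_le_log two_pos (by exact_mod_cast hT)
  have hlog2 : 0 < Real.log 2 := Real.log_pos one_lt_two
  have ha := hlog2.trans_le ha2
  have hl := hlog2.trans_le hl2
  have hT2 : (2 : ℝ) ≤ T := by exact_mod_cast hT
  set L := Real.log (T * B.Pol.card / δ)
  set R := balancedRate (K * L) B.disCoeff T (Real.log T) with hR
  have hR0 : 0 ≤ R := by rw [hR, balancedRate]; positivity
  have hexplore : B.disCoeff * √(ε * K * T * L) ≤ R := by
    rcases hθ.eq_or_lt with hθ0 | hθ0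
    · rwa [← hθ0, zero_mul]
    · have hle := mul_sqrt_tunedParam_le ha hθ0 (two_pos.trans_le hT2) hl
      rwa [← hε, ← mul_assoc, mul_right_comm] at hle
  refine (h.integral_regret_cond_le_of_sum_le hδ hδ1 hτ (one_le_two.trans hT)
    (hε ▸ tunedParam_pos) (hε ▸ tunedParam_le_one) hR0
    (fun hθ1 => by linarith [one_le_two_mul_balancedRate ha2 hθ1 hT2 hl2])
    fun hθ1 => hε ▸ sum_Icc_min_one_div_tunedParam_le ha hθ1 hT).trans ?_
  calc 1 / τ * (690 * R + 168 * (B.disCoeff * √(ε * K * T * L)))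
      ≤ 1 / τ * (690 * R + 168 * R) := by gcongr
    _ = 858 * (1 / τ * R) := by ring

end IsRun

end Conclusion

end ActiveGreedy

end

open MeasureTheory ProbabilityTheory ActiveGreedy in
theorem mainTheorem1 :
    ∃ C : ℝ, 0 < C ∧
      -- high-probability event and regret bound for every exploration parameter
      (∀ (K T : ℕ) (δ ε τ : ℝ), 2 ≤ T → 0 < δ → δ < 1 → 0 < ε → ε ≤ 1 →
        ∀ (X : Type*) [MeasurableSpace X] (B : Problem X K), B.Massart τ →
        ∀ (Ω : Type*) [mΩ : MeasurableSpace Ω] (μ : Measure Ω) [IsProbabilityMeasure μ]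
          (𝓕 : Filtration ℕ mΩ) (S : Ω → Transcript X K), IsRun B ε δ μ 𝓕 S →
          1 - δ ≤ μ.real (goodEvent B ε δ S) ∧
          ∫ ω, (S ω).regret B.opt T ∂μ[|goodEvent B ε δ S] ≤
            C * (K * Real.log (T * B.Pol.card / δ) / (τ * ε) * Real.log T
              + B.disCoeff / τ *
                Real.sqrt (ε * K * T * Real.log (T * B.Pol.card / δ)))) ∧
      -- tuned exploration parameter, which depends only on `K`, `|Π|`, `T`, `δ` and `θ`
      (∀ (K N T : ℕ) (δ θ : ℝ), 2 ≤ T → 0 < δ → δ < 1 →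
        ∃ ε : ℝ, 0 < ε ∧ ε ≤ 1 ∧
        ∀ (X : Type*) [MeasurableSpace X] (B : Problem X K), B.Pol.card = N → B.disCoeff = θ →
        ∀ τ : ℝ, B.Massart τ →
        ∀ (Ω : Type*) [mΩ : MeasurableSpace Ω] (μ : Measure Ω) [IsProbabilityMeasure μ]
          (𝓕 : Filtration ℕ mΩ) (S : Ω → Transcript X K), IsRun B ε δ μ 𝓕 S →
          ∫ ω, (S ω).regret B.opt T ∂μ[|goodEvent B ε δ S] ≤
            C * (1 / τ * (θ * K * Real.log (T * N / δ)) ^ (2 / 3 : ℝ)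
              * (T * Real.log T) ^ (1 / 3 : ℝ))) := by
  refine ⟨858, by norm_num, fun K T δ ε τ hT hδ hδ1 hε hε1 X _ B hτ Ω _ μ _ 𝓕 S h => ⟨?_, ?_⟩,
    fun K N T δ θ hT hδ hδ1 => ⟨tunedParam (K * Real.log (T * N / δ)) θ T (Real.log T),
      tunedParam_pos, tunedParam_le_one, ?_⟩⟩
  · linarith [h.one_sub_half_le_measureReal_goodEvent hε hε1 hδ hδ1]
  · have hτ0 := hτ.1
    have hθ := B.disCoeff_nonneg
    have hL := log_div_nonneg (one_le_two.trans hT) B.one_le_card hδ hδ1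
    refine (h.integral_regret_cond_le_of_massart hδ hδ1 hτ hT hε hε1).trans ?_
    gcongr
    norm_num
  · rintro X _ B rfl rfl τ hτ Ω _ μ _ 𝓕 S h
    rw [mul_assoc B.disCoeff, mul_assoc (1 / τ)]
    exact h.integral_regret_cond_le_of_tunedParam hδ hδ1 hτ hT rfl
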